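/- Let $\langle f,g\rangle=\int_{\mathbb R} f\,\overline g\,dx$ on $L_2=L_2(\mathbb R)$ (complex-valued functions), $\Omega=\mathbb R\setminus\{0\}$, and let $W_2^1(\Omega)$ be the space of $\psi\in L_2$ whose weak derivative $\psi'$ on $\Omega$ lies in $L_2$; such $\psi$ have one-sided boundary values $\psi(\pm0)$. For $v_1,v_2\in L_2$ and $\alpha\in\mathbb R$ let $A(v_1,v_2,\alpha)$ be the operator in $L_2$ $$A(v_1,v_2,\alpha)\psi=i\psi'+v_1\Bigl[\psi(-0)+\tfrac i2\langle\psi,v_1\rangle\Bigr]+v_2\Bigl[\psi(+0)-\tfrac i2\langle\psi,v_2\rangle\Bigr]$$ with domain $$\bigl\{\psi\in W_2^1(\Omega):\ \psi(+0)-i\langle\psi,v_2\rangle=e^{i\alpha}[\psi(-0)+i\langle\psi,v_1\rangle]\bigr\}.$$ Let $\theta$ be the Heaviside function ($\theta(t)=1$ for $t>0$ and $\theta(t)=0$ for $t\le 0$) and, for $z\in\mathbb C\setminus\mathbb R$, put $$g_z(x)=i\,\mathrm{sign}(\mathrm{Im}\,z)\,\theta(-x\,\mathrm{Im}\,z)\,e^{-izx},\qquad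 \beta(z,\alpha)=i(1-e^{-i\alpha})\theta(\mathrm{Im}\,z)+i(e^{i\alpha}-1)\theta(-\mathrm{Im}\,z),$$ $$\mathcal G_z(x,y;\alpha)=g_z(x-y)+g_z(x)\,\beta(z,\alpha)\,\overline{g_{\bar z}(y)},$$ $$E_0(x,z)=\mathcal G_z(x,-0;\alpha)=\lim_{y\to0^-}\mathcal G_z(x,y;\alpha),\qquad E_k(x,z)=\int_{\mathbb R}\mathcal G_z(x,y;\alpha)v_k(y)\,dy\quad(k=1,2),$$ $$\mathcal E_1=E_1+2iE_0,\qquad \mathcal E_2=E_2-2ie^{-i\alpha}E_0 .$$ Let $\Gamma(z)=(\gamma_{jk}(z))_{j,k=1}^2$ be the matrix with entries (where $E_j$ without argument means $E_j(\cdot,z)$) $$\begin{aligned} \gamma_{11}(z)&=2i\Bigl(\mathrm{sign}(\mathrm{Im}\,z)+e^{i\alpha}\langle v_2,E_0(\cdot,\bar z)\rangle-e^{-i\alpha}\langle E_0,v_2\rangle-\tfrac i2\langle E_2,v_2\rangle\Bigr),\\ \gamma_{12}(z)&=2i\Bigl(2e^{-i\alpha}\theta(\mathrm{Im}\,z)+\langle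 v_2,E_0(\cdot,\bar z)\rangle+e^{-i\alpha}\langle E_0,v_1\rangle+\tfrac i2\langle E_2,v_1\rangle\Bigr),\\ \gamma_{21}(z)&=-2i\Bigl(2e^{i\alpha}\theta(-\mathrm{Im}\,z)+e^{i\alpha}\langle v_1,E_0(\cdot,\bar z)\rangle+\langle E_0,v_2\rangle-\tfrac i2\langle E_1,v_2\rangle\Bigr),\\ \gamma_{22}(z)&=-2i\Bigl(-\mathrm{sign}(\mathrm{Im}\,z)+\langle v_1,E_0(\cdot,\bar z)\rangle-\langle E_0,v_1\rangle+\tfrac i2\langle E_1,v_1\rangle\Bigr). \end{aligned}$$ **Theorem.** For all $v_1,v_2\in L_2$ and $\alpha\in\mathbb R$ the operator $A(v_1,v_2,\alpha)$ is self-adjoint in $L_2$. For every nonreal $z$: the limit and all integrals above exist, and $E_0(\cdot,z)$ and $\int\mathcal G_z(\cdot,y;\alpha)v(y)\,dy$, for every $v\in L_2$ (in particular $E_1(\cdot,z)$ and $E_2(\cdot,z)$), lie in $L_2$; $\Gamma(\bar z)^*=\Gamma(z)$; the determinant $\gamma(z)=\det\Gamma(z)$ satisfies $\overline{\gamma(\bar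 z)}=\gamma(z)\neq0$; and the resolvent exists as a bounded operator on $L_2$ and is the integral operator $$\bigl((A(v_1,v_2,\alpha)-zI)^{-1}h\bigr)(x)=\int_{\mathbb R}\mathcal G_z(x,y;v_1,v_2,\alpha)\,h(y)\,dy\quad\text{for a.e. }x,\qquad h\in L_2,$$ with kernel $$\mathcal G_z(x,y;v_1,v_2,\alpha)=\mathcal G_z(x,y;\alpha)-\frac1{\gamma(z)}\sum_{j,k=1}^2\mathcal E_j(x,z)\,\gamma_{jk}(z)\,\overline{\mathcal E_k(y,\bar z)},$$ the last integral being absolutely convergent for every $x$. -/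

import Mathlib

open MeasureTheory Filter Topology Set
open scoped ContDiff ComplexConjugate

namespace NonlocalMomentum

theorem exists_tsupport_subset_Ioo {φ : ℝ → ℝ} (hc : HasCompactSupport φ) :
    ∃ M : ℝ, 0 < M ∧ tsupport φ ⊆ Ioo (-M) M := by
  obtain ⟨R, hR⟩ := hc.isCompact.isBounded.subset_ball 0
  refine ⟨|R| + 1, by positivity, fun x hx => ?_⟩
  have := hR hx
  rw [Metric.mem_ball, dist_zero_right, Real.norm_eq_abs] at this
  have h2 := abs_lt.1 (this.trans_le (le_abs_self R))
  constructor <;> linarith [h2.1, h2.2]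

theorem intervalIntegrable_of_locallyIntegrable {E : Type*} [NormedAddCommGroup E]
    {w : ℝ → E} (hw : LocallyIntegrable w) (a b : ℝ) : IntervalIntegrable w volume a b :=
  intervalIntegrable_iff.mpr <|
    (hw.integrableOn_isCompact isCompact_uIcc).mono_set uIoc_subset_uIcc

theorem integral_deriv_mul_primitive {w : ℝ → ℝ} (hw : LocallyIntegrable w)
    {φ : ℝ → ℝ} (hφ : ContDiff ℝ ∞ φ) (hc : HasCompactSupport φ) :
    ∫ x, deriv φ x * (∫ t in (0 : ℝ)..x, w t) = -∫ x, φ x * w x := by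
  obtain ⟨M, hM, hsupp⟩ := exists_tsupport_subset_Ioo hc
  have hwi : IntervalIntegrable w volume (-M) M := intervalIntegrable_of_locallyIntegrable hw _ _
  have h0 : (0 : ℝ) ∈ uIcc (-M) M := by
    rw [uIcc_of_le (by linarith)]; constructor <;> linarith
  have hW := hwi.absolutelyContinuousOnInterval_intervalIntegral h0
  have hφa : AbsolutelyContinuousOnInterval φ (-M) M :=
    ContDiffOn.absolutelyContinuousOnInterval (hφ.of_le (by simp)).contDiffOn
  have key := hφa.integral_deriv_mul_eq_sub hW
  have e1 : φ M = 0 := image_eq_zero_of_notMem_tsupport fun h => lt_irrefl _ (hsupp h).2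
  have e2 : φ (-M) = 0 := image_eq_zero_of_notMem_tsupport fun h => lt_irrefl _ (hsupp h).1
  rw [e1, e2] at key
  have hWc : Continuous fun x => ∫ t in (0 : ℝ)..x, w t :=
    intervalIntegral.continuous_primitive (intervalIntegrable_of_locallyIntegrable hw) 0
  have hdφ : Continuous (deriv φ) := hφ.continuous_deriv (by simp)
  have s1 : Function.support (fun x => deriv φ x * ∫ t in (0 : ℝ)..x, w t) ⊆ Ioc (-M) M :=
    fun x hx => Ioo_subset_Ioc_self <| hsupp <| support_deriv_subset <|
      left_ne_zero_of_mul (Function.mem_support.1 hx)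
  have s2 : Function.support (fun x => φ x * w x) ⊆ Ioc (-M) M :=
    fun x hx => Ioo_subset_Ioc_self <| hsupp <| subset_tsupport _ <|
      left_ne_zero_of_mul (Function.mem_support.1 hx)
  rw [← intervalIntegral.integral_eq_integral_of_support_subset s1,
    ← intervalIntegral.integral_eq_integral_of_support_subset s2, eq_neg_iff_add_eq_zero,
    ← intervalIntegral.integral_add
      (f := fun x => deriv φ x * ∫ t in (0 : ℝ)..x, w t) (g := fun x => φ x * w x)
      ((hdφ.mul hWc).intervalIntegrable _ _) (hwi.continuousOn_mul hφ.continuous.continuousOn)]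
  rw [intervalIntegral.integral_congr_ae (g := fun x => deriv φ x * (∫ t in (0 : ℝ)..x, w t) +
    φ x * deriv (fun x => ∫ t in (0 : ℝ)..x, w t) x), key]
  · simp
  · filter_upwards [LocallyIntegrable.ae_hasDerivAt_integral hw] with x hx _
    rw [(hx 0).deriv]

theorem integral_deriv_smul_primitive {w : ℝ → ℂ} (hw : LocallyIntegrable w)
    {φ : ℝ → ℝ} (hφ : ContDiff ℝ ∞ φ) (hc : HasCompactSupport φ) :
    ∫ x, deriv φ x • (∫ t in (0 : ℝ)..x, w t) = -∫ x, φ x • w x := by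
  have hWc : Continuous fun x => ∫ t in (0 : ℝ)..x, w t :=
    intervalIntegral.continuous_primitive (intervalIntegrable_of_locallyIntegrable hw) 0
  have hdφ : Continuous (deriv φ) := hφ.continuous_deriv (by simp)
  have i1 : Integrable fun x => deriv φ x • (∫ t in (0 : ℝ)..x, w t) :=
    (hdφ.smul hWc).integrable_of_hasCompactSupport hc.deriv.smul_right
  have i2 : Integrable fun x => φ x • w x :=
    hw.integrable_smul_left_of_hasCompactSupport hφ.continuous hc
  have hre : LocallyIntegrable fun x => (w x).re := fun x =>
    (hw x).imp fun s hs => ⟨hs.1, hs.2.re⟩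
  have him : LocallyIntegrable fun x => (w x).im := fun x =>
    (hw x).imp fun s hs => ⟨hs.1, hs.2.im⟩
  have cre (x : ℝ) : (∫ t in (0 : ℝ)..x, w t).re = ∫ t in (0 : ℝ)..x, (w t).re :=
    (Complex.reCLM.intervalIntegral_comp_comm
      (intervalIntegrable_of_locallyIntegrable hw 0 x)).symm
  have cim (x : ℝ) : (∫ t in (0 : ℝ)..x, w t).im = ∫ t in (0 : ℝ)..x, (w t).im :=
    (Complex.imCLM.intervalIntegral_comp_comm
      (intervalIntegrable_of_locallyIntegrable hw 0 x)).symm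
  apply Complex.ext
  · have a1 := Complex.reCLM.integral_comp_comm i1
    have a2 := Complex.reCLM.integral_comp_comm i2
    have a3 := integral_deriv_mul_primitive hre hφ hc
    simp only [Complex.reCLM_apply, Complex.smul_re, smul_eq_mul, cre] at a1 a2
    rw [Complex.neg_re, ← a1, ← a2, a3]
  · have a1 := Complex.imCLM.integral_comp_comm i1
    have a2 := Complex.imCLM.integral_comp_comm i2
    have a3 := integral_deriv_mul_primitive him hφ hc
    simp only [Complex.imCLM_apply, Complex.smul_im, smul_eq_mul, cim] at a1 a2
    rw [Complex.neg_im, ← a1, ← a2, a3]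

theorem ae_eq_const_of_integral_deriv_smul {U : Set ℝ} (hU : IsOpen U) (hU' : U.OrdConnected)
    {p : ℝ} (hp : p ∈ U) {f : ℝ → ℂ} (hf : LocallyIntegrable f)
    (h : ∀ φ : ℝ → ℝ, ContDiff ℝ ∞ φ → HasCompactSupport φ → tsupport φ ⊆ U →
      ∫ x, deriv φ x • f x = 0) :
    ∃ c : ℂ, ∀ᵐ x, x ∈ U → f x = c := by
  obtain ⟨η₀, hη₀s, hη₀c, hη₀d, hη₀r, hη₀p⟩ :=
    exists_contDiff_tsupport_subset (n := ⊤) (hU.mem_nhds hp)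
  have hη₀i : 0 < ∫ x, η₀ x := by
    refine hη₀d.continuous.integral_pos_of_hasCompactSupport_nonneg_nonzero hη₀c
      (fun x => (hη₀r ⟨x, rfl⟩).1) (x := p) (by simp [hη₀p])
  set m := ∫ x, η₀ x
  have hη₀int : Integrable η₀ := hη₀d.continuous.integrable_of_hasCompactSupport hη₀c
  refine ⟨m⁻¹ • ∫ x, η₀ x • f x, ?_⟩
  set c := m⁻¹ • ∫ x, η₀ x • f x with hcdef
  have key := hU.ae_eq_zero_of_integral_contDiff_smul_eq_zero (μ := volume)
    (f := fun x => f x - c) ((hf.sub (locallyIntegrable_const c)).locallyIntegrableOn U) ?_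
  · filter_upwards [key] with x hx hxU
    exact sub_eq_zero.1 (hx hxU)
  intro φ hφ hφc hφs
  have hφint : Integrable φ := hφ.continuous.integrable_of_hasCompactSupport hφc
  set k := m⁻¹ * ∫ x, φ x with hk
  set ρ : ℝ → ℝ := fun x => φ x - k * η₀ x with hρ
  have hρd : ContDiff ℝ ∞ ρ := hφ.sub (contDiff_const.mul hη₀d)
  have hρc : HasCompactSupport ρ := hφc.sub hη₀c.mul_left
  have hρs : tsupport ρ ⊆ U := by
    refine (closure_mono (?_ : Function.support ρ ⊆ tsupport φ ∪ tsupport η₀)).trans ?_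
    · intro x hx
      by_contra hne
      simp only [mem_union, not_or] at hne
      apply hx
      simp [hρ, image_eq_zero_of_notMem_tsupport hne.1, image_eq_zero_of_notMem_tsupport hne.2]
    · rw [((isClosed_tsupport φ).union (isClosed_tsupport η₀)).closure_eq]
      exact union_subset hφs hη₀s
  have hρi : ∫ x, ρ x = 0 := by
    rw [hρ, integral_sub hφint (hη₀int.const_mul k), integral_const_mul, hk]
    change _ - m⁻¹ * _ * m = 0
    field_simp
    ring
  -- a compact interval inside `U` that contains the support of `ρ`
  obtain ⟨a, b, ha, hb, hab⟩ : ∃ a b, a ∈ U ∧ b ∈ U ∧ tsupport ρ ⊆ Icc a b := by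
    by_cases hne : (tsupport ρ).Nonempty
    · have hK : IsCompact (tsupport ρ) := hρc
      exact ⟨sInf (tsupport ρ), sSup (tsupport ρ), hρs (hK.sInf_mem hne), hρs (hK.sSup_mem hne),
        fun x hx => ⟨csInf_le hK.bddBelow hx, le_csSup hK.bddAbove hx⟩⟩
    · exact ⟨p, p, hp, hp, by simp [not_nonempty_iff_eq_empty.1 hne]⟩
  set χ : ℝ → ℝ := fun x => ∫ t in a..x, ρ t with hχ
  have hχ' (x : ℝ) : HasDerivAt χ (ρ x) x :=
    intervalIntegral.integral_hasDerivAt_right (hρd.continuous.intervalIntegrable _ _)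
      (hρd.continuous.stronglyMeasurableAtFilter _ _) hρd.continuous.continuousAt
  have hχd : deriv χ = ρ := funext fun x => (hχ' x).deriv
  have hχs : Function.support χ ⊆ Icc a b := by
    intro x hx
    by_contra hxn
    apply hx
    rw [mem_Icc, not_and_or, not_le, not_le] at hxn
    rcases hxn with hlt | hlt
    · refine intervalIntegral.integral_zero_ae ?_
      have : ∀ᵐ t : ℝ, t ≠ a := by simp [ae_iff, measure_singleton]
      filter_upwards [this] with t hta ht
      rw [uIoc_of_ge hlt.le] at ht
      refine image_eq_zero_of_notMem_tsupport fun hm => hta (le_antisymm ht.2 (hab hm).1)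
    · by_cases hne : a ≤ b
      · have s : Function.support ρ ⊆ Ioc (a - 1) x := fun t ht =>
          ⟨by linarith [(hab (subset_tsupport _ ht)).1],
            ((hab (subset_tsupport _ ht)).2.trans hlt.le)⟩
        have e := intervalIntegral.integral_eq_integral_of_support_subset (μ := volume) s
        rw [hρi, ← intervalIntegral.integral_add_adjacent_intervals (b := a)
          (hρd.continuous.intervalIntegrable _ _) (hρd.continuous.intervalIntegrable _ _)] at e
        have e0 : ∫ t in (a - 1)..a, ρ t = 0 := by
          refine intervalIntegral.integral_zero_ae ?_
          have : ∀ᵐ t : ℝ, t ≠ a := by simp [ae_iff, measure_singleton]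
          filter_upwards [this] with t hta ht
          rw [uIoc_of_le (by linarith)] at ht
          refine image_eq_zero_of_notMem_tsupport fun hm => hta (le_antisymm ht.2 (hab hm).1)
        rw [e0, zero_add] at e
        exact e
      · have : ρ = 0 := by
          funext t
          refine image_eq_zero_of_notMem_tsupport fun hm => hne ((hab hm).1.trans (hab hm).2)
        simp [hχ, this]
  have hχts : tsupport χ ⊆ Icc a b := closure_minimal hχs isClosed_Icc
  have hχU : tsupport χ ⊆ U := hχts.trans (hU'.out ha hb)
  have hχc : HasCompactSupport χ := isCompact_Icc.of_isClosed_subset (isClosed_tsupport _) hχts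
  have hχsm : ContDiff ℝ ∞ χ :=
    contDiff_infty_iff_deriv.2 ⟨fun x => (hχ' x).differentiableAt, hχd ▸ hρd⟩
  have h0 := h χ hχsm hχc hχU
  rw [hχd] at h0
  have i1 : Integrable fun x => φ x • f x :=
    hf.integrable_smul_left_of_hasCompactSupport hφ.continuous hφc
  have i2 : Integrable fun x => η₀ x • f x :=
    hf.integrable_smul_left_of_hasCompactSupport hη₀d.continuous hη₀c
  have h1 : ∫ x, ρ x • f x = (∫ x, φ x • f x) - k • ∫ x, η₀ x • f x := by
    rw [← integral_smul, ← integral_sub (g := fun x => k • η₀ x • f x) i1 (i2.smul k)]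
    congr 1; funext x
    simp only [hρ, sub_smul, mul_smul]
  rw [h0] at h1
  simp_rw [smul_sub]
  rw [integral_sub i1 (hφint.smul_const c), integral_smul_const, sub_eq_zero.1 h1.symm,
    hcdef, smul_smul, hk, mul_comm, sub_self]


/-- The Hilbert space `L₂(ℝ)` of square integrable complex functions. -/
abbrev L2R : Type := Lp ℂ 2 (volume : Measure ℝ)

/-- `⟨f, g⟩ = ∫ f(x) conj (g(x)) dx`, linear in the first argument. -/
noncomputable def pairing (f g : ℝ → ℂ) : ℂ := ∫ x, f x * conj (g x)

/-- `w` is the weak derivative of `u` on the punctured line `Ω = ℝ \ {0}`, tested against smooth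
functions with compact support contained in `Ω`. -/
def HasWeakDeriv (u w : ℝ → ℂ) : Prop :=
  ∀ φ : ℝ → ℝ, ContDiff ℝ ∞ φ → HasCompactSupport φ → tsupport φ ⊆ {0}ᶜ →
    ∫ x, deriv φ x • u x = -∫ x, φ x • w x

/-- The one-sided boundary value `u(-0)`: the limit of `u` at `0` from the left, up to null sets. -/
noncomputable def leftValue (u : ℝ → ℂ) : ℂ := limUnder (𝓝[<] (0 : ℝ) ⊓ ae volume) u

/-- The one-sided boundary value `u(+0)`: the limit of `u` at `0` from the right, up to null
sets. -/
noncomputable def rightValue (u : ℝ → ℂ) : ℂ := limUnder (𝓝[>] (0 : ℝ) ⊓ ae volume) u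

theorem L2R.locallyIntegrable (ψ : L2R) : LocallyIntegrable (ψ : ℝ → ℂ) :=
  (Lp.memLp ψ).locallyIntegrable (by norm_num)

theorem pairing_eq_inner (ψ v : L2R) : pairing ψ v = inner ℂ v ψ := by
  rw [L2.inner_def]; rfl

theorem HasWeakDeriv.unique {u : ℝ → ℂ} {w₁ w₂ : L2R} (h₁ : HasWeakDeriv u w₁)
    (h₂ : HasWeakDeriv u w₂) : w₁ = w₂ := by
  have hl₁ := L2R.locallyIntegrable w₁
  have hl₂ := L2R.locallyIntegrable w₂
  have key := (isOpen_compl_singleton (x := (0 : ℝ))).ae_eq_zero_of_integral_contDiff_smul_eq_zero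
    (μ := volume) (f := fun x => w₁ x - w₂ x) ((hl₁.sub hl₂).locallyIntegrableOn _) ?_
  · have hne : ∀ᵐ x : ℝ, x ≠ 0 := by simp [ae_iff, measure_singleton]
    refine Lp.ext ?_
    filter_upwards [key, hne] with x hx hx0
    exact sub_eq_zero.1 (hx hx0)
  intro φ hφ hc hs
  simp_rw [smul_sub]
  rw [integral_sub (hl₁.integrable_smul_left_of_hasCompactSupport hφ.continuous hc)
    (hl₂.integrable_smul_left_of_hasCompactSupport hφ.continuous hc), sub_eq_zero]
  exact neg_injective ((h₁ φ hφ hc hs).symm.trans (h₂ φ hφ hc hs))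

theorem HasWeakDeriv.congr {u u' w w' : ℝ → ℂ} (h : HasWeakDeriv u w) (hu : u =ᵐ[volume] u')
    (hw : w =ᵐ[volume] w') : HasWeakDeriv u' w' := by
  intro φ hφ hc hs
  have e1 : ∫ x, deriv φ x • u' x = ∫ x, deriv φ x • u x :=
    integral_congr_ae (by filter_upwards [hu] with x hx; rw [hx])
  have e2 : ∫ x, φ x • w' x = ∫ x, φ x • w x :=
    integral_congr_ae (by filter_upwards [hw] with x hx; rw [hx])
  rw [e1, e2, h φ hφ hc hs]

theorem HasWeakDeriv.add {u₁ u₂ w₁ w₂ : L2R} (h₁ : HasWeakDeriv u₁ w₁)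
    (h₂ : HasWeakDeriv u₂ w₂) : HasWeakDeriv (u₁ + u₂ : L2R) (w₁ + w₂ : L2R) := by
  refine HasWeakDeriv.congr (u := fun x => u₁ x + u₂ x) (w := fun x => w₁ x + w₂ x) ?_
    (Lp.coeFn_add u₁ u₂).symm (Lp.coeFn_add w₁ w₂).symm
  intro φ hφ hc hs
  have hdφ : Continuous (deriv φ) := hφ.continuous_deriv (by simp)
  simp_rw [smul_add]
  rw [integral_add
      ((L2R.locallyIntegrable u₁).integrable_smul_left_of_hasCompactSupport hdφ hc.deriv)
      ((L2R.locallyIntegrable u₂).integrable_smul_left_of_hasCompactSupport hdφ hc.deriv),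
    integral_add
      ((L2R.locallyIntegrable w₁).integrable_smul_left_of_hasCompactSupport hφ.continuous hc)
      ((L2R.locallyIntegrable w₂).integrable_smul_left_of_hasCompactSupport hφ.continuous hc),
    h₁ φ hφ hc hs, h₂ φ hφ hc hs, neg_add]

theorem HasWeakDeriv.smul (c : ℂ) {u w : L2R} (h : HasWeakDeriv u w) :
    HasWeakDeriv (c • u : L2R) (c • w : L2R) := by
  refine HasWeakDeriv.congr (u := fun x => c • u x) (w := fun x => c • w x) ?_
    (Lp.coeFn_smul c u).symm (Lp.coeFn_smul c w).symm
  intro φ hφ hc hs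
  simp_rw [smul_comm _ c]
  rw [integral_smul, integral_smul, h φ hφ hc hs, smul_neg]

theorem HasWeakDeriv.zero : HasWeakDeriv (0 : L2R) (0 : L2R) := by
  have h : (fun _ : ℝ => (0 : ℂ)) =ᵐ[volume] (0 : L2R) := (Lp.coeFn_zero ℂ 2 volume).symm
  refine HasWeakDeriv.congr (u := fun _ => 0) (w := fun _ => 0) ?_ h h
  intro φ _ _ _
  simp

instance neBot_left : (𝓝[<] (0 : ℝ) ⊓ ae volume).NeBot := by
  rw [inf_neBot_iff]
  intro s hs t ht
  obtain ⟨l, hl, hls⟩ := mem_nhdsLT_iff_exists_Ioo_subset.1 hs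
  by_contra hne
  have : Ioo l 0 ⊆ tᶜ := fun x hx hxt => hne ⟨x, hls hx, hxt⟩
  have h0 : volume (Ioo l (0 : ℝ)) = 0 := measure_mono_null this ht
  rw [Real.volume_Ioo, ENNReal.ofReal_eq_zero] at h0
  have : l < 0 := hl
  linarith

instance neBot_right : (𝓝[>] (0 : ℝ) ⊓ ae volume).NeBot := by
  rw [inf_neBot_iff]
  intro s hs t ht
  obtain ⟨l, hl, hls⟩ := mem_nhdsGT_iff_exists_Ioo_subset.1 hs
  by_contra hne
  have : Ioo 0 l ⊆ tᶜ := fun x hx hxt => hne ⟨x, hls hx, hxt⟩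
  have h0 : volume (Ioo (0 : ℝ) l) = 0 := measure_mono_null this ht
  rw [Real.volume_Ioo, ENNReal.ofReal_eq_zero] at h0
  have : 0 < l := hl
  linarith

theorem HasWeakDeriv.exists_ae_eq {u w : L2R} (h : HasWeakDeriv u w) {U : Set ℝ} (hU : IsOpen U)
    (hU' : U.OrdConnected) {p : ℝ} (hp : p ∈ U) (h0 : (0 : ℝ) ∉ U) :
    ∃ c : ℂ, ∀ᵐ x, x ∈ U → u x = c + ∫ t in (0 : ℝ)..x, w t := by
  have hu := L2R.locallyIntegrable u
  have hw := L2R.locallyIntegrable w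
  have hWc : Continuous fun x => ∫ t in (0 : ℝ)..x, w t :=
    intervalIntegral.continuous_primitive (intervalIntegrable_of_locallyIntegrable hw) 0
  obtain ⟨c, hc⟩ := ae_eq_const_of_integral_deriv_smul hU hU' hp
    (f := fun x => u x - ∫ t in (0 : ℝ)..x, w t) (hu.sub hWc.locallyIntegrable) (by
      intro φ hφ hφc hφs
      have hdφ : Continuous (deriv φ) := hφ.continuous_deriv (by simp)
      simp_rw [smul_sub]
      rw [integral_sub (hu.integrable_smul_left_of_hasCompactSupport hdφ hφc.deriv)
        (hWc.locallyIntegrable.integrable_smul_left_of_hasCompactSupport hdφ hφc.deriv),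
        h φ hφ hφc (fun x hx hx0 => h0 (hx0 ▸ hφs hx)),
        integral_deriv_smul_primitive hw hφ hφc, sub_self])
  refine ⟨c, ?_⟩
  filter_upwards [hc] with x hx hxU
  rw [← hx hxU, sub_add_cancel]

theorem tendsto_primitive (w : L2R) (c : ℂ) (l : Filter ℝ) (hl : l ≤ 𝓝 0) :
    Tendsto (fun x => c + ∫ t in (0 : ℝ)..x, w t) l (𝓝 c) := by
  have hWc : Continuous fun x => c + ∫ t in (0 : ℝ)..x, w t :=
    continuous_const.add (intervalIntegral.continuous_primitive
      (intervalIntegrable_of_locallyIntegrable (L2R.locallyIntegrable w)) 0)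
  simpa using (hWc.tendsto 0).mono_left hl

/-- The Sobolev space `W₂¹(Ω)`, `Ω = ℝ \ {0}`: functions in `L₂` with weak derivative in `L₂`. -/
def sobolev : Submodule ℂ L2R where
  carrier := {ψ | ∃ w : L2R, HasWeakDeriv ψ w}
  zero_mem' := ⟨0, HasWeakDeriv.zero⟩
  add_mem' := fun ⟨_, h₁⟩ ⟨_, h₂⟩ => ⟨_, h₁.add h₂⟩
  smul_mem' := fun c _ ⟨_, h⟩ => ⟨_, h.smul c⟩

theorem tendsto_leftValue {ψ : L2R} (hψ : ψ ∈ sobolev) :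
    Tendsto (ψ : ℝ → ℂ) (𝓝[<] (0 : ℝ) ⊓ ae volume) (𝓝 (leftValue ψ)) := by
  obtain ⟨w, hw⟩ := hψ
  obtain ⟨c, hc⟩ := hw.exists_ae_eq isOpen_Iio ordConnected_Iio
    (p := -1) (by simp : (-1 : ℝ) ∈ Iio (0 : ℝ)) (by simp)
  refine tendsto_nhds_limUnder ⟨c, ?_⟩
  refine (tendsto_primitive w c _ (inf_le_left.trans nhdsWithin_le_nhds)).congr' ?_
  filter_upwards [mem_inf_of_right hc, mem_inf_of_left self_mem_nhdsWithin] with x hx hxs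
  exact (hx hxs).symm

theorem tendsto_rightValue {ψ : L2R} (hψ : ψ ∈ sobolev) :
    Tendsto (ψ : ℝ → ℂ) (𝓝[>] (0 : ℝ) ⊓ ae volume) (𝓝 (rightValue ψ)) := by
  obtain ⟨w, hw⟩ := hψ
  obtain ⟨c, hc⟩ := hw.exists_ae_eq isOpen_Ioi ordConnected_Ioi
    (p := 1) (by simp : (1 : ℝ) ∈ Ioi (0 : ℝ)) (by simp)
  refine tendsto_nhds_limUnder ⟨c, ?_⟩
  refine (tendsto_primitive w c _ (inf_le_left.trans nhdsWithin_le_nhds)).congr' ?_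
  filter_upwards [mem_inf_of_right hc, mem_inf_of_left self_mem_nhdsWithin] with x hx hxs
  exact (hx hxs).symm

theorem leftValue_add {ψ φ : L2R} (hψ : ψ ∈ sobolev) (hφ : φ ∈ sobolev) :
    leftValue (ψ + φ : L2R) = leftValue ψ + leftValue φ :=
  tendsto_nhds_unique (tendsto_leftValue (sobolev.add_mem hψ hφ))
    (((tendsto_leftValue hψ).add (tendsto_leftValue hφ)).congr'
      (EventuallyEq.filter_mono (Lp.coeFn_add ψ φ).symm inf_le_right))

theorem rightValue_add {ψ φ : L2R} (hψ : ψ ∈ sobolev) (hφ : φ ∈ sobolev) :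
    rightValue (ψ + φ : L2R) = rightValue ψ + rightValue φ :=
  tendsto_nhds_unique (tendsto_rightValue (sobolev.add_mem hψ hφ))
    (((tendsto_rightValue hψ).add (tendsto_rightValue hφ)).congr'
      (EventuallyEq.filter_mono (Lp.coeFn_add ψ φ).symm inf_le_right))

theorem leftValue_smul (c : ℂ) {ψ : L2R} (hψ : ψ ∈ sobolev) :
    leftValue (c • ψ : L2R) = c * leftValue ψ :=
  tendsto_nhds_unique (tendsto_leftValue (sobolev.smul_mem c hψ))
    (((tendsto_leftValue hψ).const_mul c).congr'
      (EventuallyEq.filter_mono (Lp.coeFn_smul c ψ).symm inf_le_right))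

theorem rightValue_smul (c : ℂ) {ψ : L2R} (hψ : ψ ∈ sobolev) :
    rightValue (c • ψ : L2R) = c * rightValue ψ :=
  tendsto_nhds_unique (tendsto_rightValue (sobolev.smul_mem c hψ))
    (((tendsto_rightValue hψ).const_mul c).congr'
      (EventuallyEq.filter_mono (Lp.coeFn_smul c ψ).symm inf_le_right))

theorem pairing_add (ψ φ v : L2R) :
    pairing (ψ + φ : L2R) v = pairing ψ v + pairing φ v := by
  simp only [pairing_eq_inner, inner_add_right]

theorem pairing_smul (c : ℂ) (ψ v : L2R) : pairing (c • ψ : L2R) v = c * pairing ψ v := by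
  simp only [pairing_eq_inner, inner_smul_right]

/-- The weak derivative `ψ ↦ ψ'` on `W₂¹(Ω)`, with values in `L₂`. -/
noncomputable def weakDeriv : sobolev →ₗ[ℂ] L2R where
  toFun ψ := ψ.2.choose
  map_add' ψ φ := (ψ + φ).2.choose_spec.unique (ψ.2.choose_spec.add φ.2.choose_spec)
  map_smul' c ψ := (c • ψ).2.choose_spec.unique (ψ.2.choose_spec.smul c)

theorem hasWeakDeriv_weakDeriv (ψ : sobolev) : HasWeakDeriv (ψ : L2R) (weakDeriv ψ) :=
  ψ.2.choose_spec

/-- The maximal operator `i d/dx + v₁ [ψ(-0) + (i/2)⟨ψ, v₁⟩] + v₂ [ψ(+0) - (i/2)⟨ψ, v₂⟩]`, defined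
on all of `W₂¹(Ω)`. -/
noncomputable def maxOp (v₁ v₂ : L2R) : L2R →ₗ.[ℂ] L2R where
  domain := sobolev
  toFun :=
    { toFun := fun ψ => Complex.I • weakDeriv ψ
        + (leftValue (ψ : L2R) + Complex.I / 2 * pairing (ψ : L2R) v₁) • v₁
        + (rightValue (ψ : L2R) - Complex.I / 2 * pairing (ψ : L2R) v₂) • v₂
      map_add' := fun ψ φ => by
        simp only [map_add, Submodule.coe_add, leftValue_add ψ.2 φ.2, rightValue_add ψ.2 φ.2,
          pairing_add]
        module
      map_smul' := fun c ψ => by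
        simp only [map_smul, Submodule.coe_smul, leftValue_smul c ψ.2, rightValue_smul c ψ.2,
          pairing_smul, RingHom.id_apply]
        module }

/-- The functions `ψ` in `W₂¹(Ω)` that satisfy the nonlocal boundary condition
`ψ(+0) - i⟨ψ, v₂⟩ = e^{iα} [ψ(-0) + i⟨ψ, v₁⟩]`. -/
noncomputable def bcDomain (v₁ v₂ : L2R) (α : ℝ) : Submodule ℂ L2R where
  carrier := {ψ | ψ ∈ sobolev ∧ rightValue ψ - Complex.I * pairing ψ v₂
    = Complex.exp (Complex.I * α) * (leftValue ψ + Complex.I * pairing ψ v₁)}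
  zero_mem' := by
    refine ⟨sobolev.zero_mem, ?_⟩
    have h1 := leftValue_smul 0 sobolev.zero_mem
    have h2 := rightValue_smul 0 sobolev.zero_mem
    have h3 := pairing_smul 0 0 v₁
    have h4 := pairing_smul 0 0 v₂
    rw [zero_smul, zero_mul] at h1 h2 h3 h4
    rw [h1, h2, h3, h4]
    simp
  add_mem' := fun {ψ φ} hψ hφ => by
    refine ⟨sobolev.add_mem hψ.1 hφ.1, ?_⟩
    rw [leftValue_add hψ.1 hφ.1, rightValue_add hψ.1 hφ.1, pairing_add, pairing_add]
    linear_combination hψ.2 + hφ.2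
  smul_mem' := fun c ψ hψ => by
    refine ⟨sobolev.smul_mem c hψ.1, ?_⟩
    rw [leftValue_smul c hψ.1, rightValue_smul c hψ.1, pairing_smul, pairing_smul]
    linear_combination c * hψ.2

/-- The operator `A(v₁, v₂, α)`: the restriction of the maximal operator to the functions that
satisfy the nonlocal boundary condition. -/
noncomputable def nonlocalOp (v₁ v₂ : L2R) (α : ℝ) : L2R →ₗ.[ℂ] L2R :=
  (maxOp v₁ v₂).domRestrict (bcDomain v₁ v₂ α)

/-- `R` is the resolvent `(A - z)⁻¹`: a bounded everywhere defined two-sided inverse of `A - z`. -/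
def IsResolvent (A : L2R →ₗ.[ℂ] L2R) (z : ℂ) (R : L2R →L[ℂ] L2R) : Prop :=
  (∀ h : L2R, ∃ hR : R h ∈ A.domain, A ⟨R h, hR⟩ - z • R h = h) ∧
    ∀ ψ : A.domain, R (A ψ - z • (ψ : L2R)) = ψ

/-- The Heaviside step function `θ`. -/
noncomputable def heaviside (t : ℝ) : ℝ := if 0 < t then 1 else 0

/-- The free Green function `g_z(x) = i sign(Im z) θ(-x Im z) e^{-izx}`. -/
noncomputable def freeGreen (z : ℂ) (x : ℝ) : ℂ :=
  Complex.I * Real.sign z.im * heaviside (-x * z.im) * Complex.exp (-Complex.I * z * x)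

/-- `β(z, α) = i (1 - e^{-iα}) θ(Im z) + i (e^{iα} - 1) θ(-Im z)`. -/
noncomputable def beta (z : ℂ) (α : ℝ) : ℂ :=
  Complex.I * (1 - Complex.exp (-Complex.I * α)) * heaviside z.im
    + Complex.I * (Complex.exp (Complex.I * α) - 1) * heaviside (-z.im)

/-- The point-interaction Green function
`𝒢_z(x, y; α) = g_z(x - y) + g_z(x) β(z, α) conj (g_{conj z}(y))`. -/
noncomputable def pointGreen (α : ℝ) (z : ℂ) (x y : ℝ) : ℂ :=
  freeGreen z (x - y) + freeGreen z x * beta z α * conj (freeGreen (conj z) y)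

/-- `E₀(x, z) = 𝒢_z(x, -0; α)`, the limit of `𝒢_z(x, y; α)` as `y` tends to `0` from the left. -/
noncomputable def E0 (α : ℝ) (z : ℂ) (x : ℝ) : ℂ := limUnder (𝓝[<] (0 : ℝ)) (pointGreen α z x)

/-- `∫ 𝒢_z(x, y; α) v(y) dy`. -/
noncomputable def greenPotential (α : ℝ) (v : L2R) (z : ℂ) (x : ℝ) : ℂ :=
  ∫ y, pointGreen α z x y * v y

/-- `(ℰ₁, ℰ₂) = (E₁ + 2i E₀, E₂ - 2i e^{-iα} E₀)`. -/
noncomputable def calE (v₁ v₂ : L2R) (α : ℝ) (z : ℂ) : Fin 2 → ℝ → ℂ :=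
  ![fun x => greenPotential α v₁ z x + 2 * Complex.I * E0 α z x,
    fun x => greenPotential α v₂ z x
      - 2 * Complex.I * Complex.exp (-Complex.I * α) * E0 α z x]

/-- The `2 × 2` matrix `Γ(z) = (γ_{jk}(z))`. -/
noncomputable def Gam (v₁ v₂ : L2R) (α : ℝ) (z : ℂ) : Matrix (Fin 2) (Fin 2) ℂ :=
  !![2 * Complex.I * (Real.sign z.im
        + Complex.exp (Complex.I * α) * pairing v₂ (E0 α (conj z))
        - Complex.exp (-Complex.I * α) * pairing (E0 α z) v₂
        - Complex.I / 2 * pairing (greenPotential α v₂ z) v₂),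
     2 * Complex.I * (2 * Complex.exp (-Complex.I * α) * heaviside z.im
        + pairing v₂ (E0 α (conj z))
        + Complex.exp (-Complex.I * α) * pairing (E0 α z) v₁
        + Complex.I / 2 * pairing (greenPotential α v₂ z) v₁);
     -2 * Complex.I * (2 * Complex.exp (Complex.I * α) * heaviside (-z.im)
        + Complex.exp (Complex.I * α) * pairing v₁ (E0 α (conj z))
        + pairing (E0 α z) v₂
        - Complex.I / 2 * pairing (greenPotential α v₁ z) v₂),
     -2 * Complex.I * (-Real.sign z.im
        + pairing v₁ (E0 α (conj z))
        - pairing (E0 α z) v₁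
        + Complex.I / 2 * pairing (greenPotential α v₁ z) v₁)]

/-- The kernel
`𝒢_z(x, y; α) - (1 / det Γ(z)) ∑_{j,k} ℰ_j(x, z) γ_{jk}(z) conj (ℰ_k(y, conj z))`. -/
noncomputable def resolventKernel (v₁ v₂ : L2R) (α : ℝ) (z : ℂ) (x y : ℝ) : ℂ :=
  pointGreen α z x y - 1 / (Gam v₁ v₂ α z).det *
    ∑ j : Fin 2, ∑ k : Fin 2,
      calE v₁ v₂ α z j x * Gam v₁ v₂ α z j k * conj (calE v₁ v₂ α (conj z) k y)

end NonlocalMomentum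

open NonlocalMomentum

namespace NonlocalMomentum

/-! Write `L = ψ(-0) + i⟨ψ, v₁⟩` and `R = ψ(+0) - i⟨ψ, v₂⟩`, and `L'`, `R'` for the same quantities
of `φ`. Integration by parts gives `⟨Aψ, φ⟩ - ⟨ψ, Aφ⟩ = i (L conj L' - R conj R')`, which vanishes
when `R = e^{iα} L` and `R' = e^{iα} L'`. So `A` is symmetric (`nonlocalOp_isFormalAdjoint`), and a
symmetric operator for which `A - z` is onto for all nonreal `z` is self-adjoint, with resolvent
bounded by `1 / |Im z|`. Everything therefore reduces to solving `(A - z) u = h` explicitly.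

Put `a = u(-0) + (i/2)⟨u, v₁⟩` and `b = u(+0) - (i/2)⟨u, v₂⟩`. The equation then reads `i u' - z u =
h - a v₁ - b v₂` away from the origin, and the boundary condition becomes `u(-0) - e^{-iα} u(+0) =
2a - 2e^{-iα} b`. Potentials of `𝒢_z(·, ·; α)` solve the inhomogeneous equation and have `u(+0) =
e^{iα} u(-0)`, while `E₀` solves the homogeneous equation with `u(-0) - e^{-iα} u(+0) = i`. The
ansatz `u = 𝒢_z h - a ℰ₁ - b ℰ₂` thus satisfies the equation and the boundary relation for all `a`,
`b`; the multiples of `E₀` in `ℰ₁`, `ℰ₂` are chosen for this.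

What is left is consistency of `a` and `b` with `u`: a linear system whose matrix is the adjugate of
`Γ(z)` and whose right side is `(⟨h, ℰ₁(·, conj z)⟩, ⟨h, ℰ₂(·, conj z)⟩)`
(`exists_nonlocalOp_eq_of_Gam`). A null vector of it would give a solution of `(A - z) u = 0`;
symmetry forces `u = 0`, and `a`, `b` are recovered from `u`, so they vanish (`det_Gam_ne_zero`).
Since the adjugate has inverse `Γ / det Γ`, solving the system produces the kernel of the theorem.
-/

/-! ### Product rule for primitives of locally integrable functions -/

/-- Primitives are absolutely continuous with the expected derivative almost everywhere, so this is
integration by parts for absolutely continuous functions. -/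
theorem mul_primitive_eq_real {w₁ w₂ : ℝ → ℝ} (h₁ : LocallyIntegrable w₁)
    (h₂ : LocallyIntegrable w₂) (c₁ c₂ x : ℝ) :
    (c₁ + ∫ t in (0 : ℝ)..x, w₁ t) * (c₂ + ∫ t in (0 : ℝ)..x, w₂ t) = c₁ * c₂ +
      ∫ t in (0 : ℝ)..x, (w₁ t * (c₂ + ∫ s in (0 : ℝ)..t, w₂ s) +
        (c₁ + ∫ s in (0 : ℝ)..t, w₁ s) * w₂ t) := by
  have hac {w : ℝ → ℝ} (hw : LocallyIntegrable w) (c : ℝ) :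
      AbsolutelyContinuousOnInterval (fun y => c + ∫ t in (0 : ℝ)..y, w t) 0 x := by
    have hc : AbsolutelyContinuousOnInterval (fun _ : ℝ => c) 0 x :=
      ContDiffOn.absolutelyContinuousOnInterval contDiffOn_const
    exact hc.add ((intervalIntegrable_of_locallyIntegrable hw
      0 x).absolutelyContinuousOnInterval_intervalIntegral left_mem_uIcc)
  have key := (hac h₁ c₁).integral_deriv_mul_eq_sub (hac h₂ c₂)
  rw [intervalIntegral.integral_same, intervalIntegral.integral_same, add_zero, add_zero] at key
  rw [eq_comm, ← eq_sub_iff_add_eq', ← key]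
  refine intervalIntegral.integral_congr_ae ?_
  filter_upwards [LocallyIntegrable.ae_hasDerivAt_integral h₁,
    LocallyIntegrable.ae_hasDerivAt_integral h₂] with t d₁ d₂ _
  rw [((d₁ 0).const_add c₁).deriv, ((d₂ 0).const_add c₂).deriv]

theorem continuous_primitive {w : ℝ → ℂ} (hw : LocallyIntegrable w) (c : ℂ) :
    Continuous fun x => c + ∫ t in (0 : ℝ)..x, w t :=
  continuous_const.add (intervalIntegral.continuous_primitive
    (intervalIntegrable_of_locallyIntegrable hw) 0)

theorem locallyIntegrable_mul_continuous {w f : ℝ → ℂ} (hw : LocallyIntegrable w)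
    (hf : Continuous f) : LocallyIntegrable fun x => w x * f x := by
  rw [locallyIntegrable_iff] at hw ⊢
  exact fun K hK => (hw K hK).mul_continuousOn hf.continuousOn hK

theorem mul_primitive_eq {w₁ w₂ : ℝ → ℂ} (h₁ : LocallyIntegrable w₁)
    (h₂ : LocallyIntegrable w₂) (c₁ c₂ : ℂ) (x : ℝ) :
    (c₁ + ∫ t in (0 : ℝ)..x, w₁ t) * (c₂ + ∫ t in (0 : ℝ)..x, w₂ t) = c₁ * c₂ +
      ∫ t in (0 : ℝ)..x, (w₁ t * (c₂ + ∫ s in (0 : ℝ)..t, w₂ s) +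
        (c₁ + ∫ s in (0 : ℝ)..t, w₁ s) * w₂ t) := by
  have hre {w : ℝ → ℂ} (h : LocallyIntegrable w) :
      LocallyIntegrable fun x => (w x).re := fun x => by
    obtain ⟨s, hs, hi⟩ := h x
    exact ⟨s, hs, hi.re⟩
  have him {w : ℝ → ℂ} (h : LocallyIntegrable w) :
      LocallyIntegrable fun x => (w x).im := fun x => by
    obtain ⟨s, hs, hi⟩ := h x
    exact ⟨s, hs, hi.im⟩
  have cre {w : ℝ → ℂ} (h : LocallyIntegrable w) (x : ℝ) :
      (∫ t in (0 : ℝ)..x, w t).re = ∫ t in (0 : ℝ)..x, (w t).re :=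
    (Complex.reCLM.intervalIntegral_comp_comm
      (intervalIntegrable_of_locallyIntegrable h 0 x)).symm
  have cim {w : ℝ → ℂ} (h : LocallyIntegrable w) (x : ℝ) :
      (∫ t in (0 : ℝ)..x, w t).im = ∫ t in (0 : ℝ)..x, (w t).im :=
    (Complex.imCLM.intervalIntegral_comp_comm
      (intervalIntegrable_of_locallyIntegrable h 0 x)).symm
  have hli : LocallyIntegrable fun t => w₁ t * (c₂ + ∫ s in (0 : ℝ)..t, w₂ s) +
        (c₁ + ∫ s in (0 : ℝ)..t, w₁ s) * w₂ t := by
    refine (locallyIntegrable_mul_continuous h₁ (continuous_primitive h₂ c₂)).add ?_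
    simpa only [mul_comm] using locallyIntegrable_mul_continuous h₂ (continuous_primitive h₁ c₁)
  have hp {u w : ℝ → ℝ} (hu : LocallyIntegrable u) (hw : LocallyIntegrable w) (c d : ℝ) :
      IntervalIntegrable (fun t => u t * (d + ∫ s in (0 : ℝ)..t, w s) +
        (c + ∫ s in (0 : ℝ)..t, u s) * w t) volume 0 x := by
    have hcont {w : ℝ → ℝ} (hw : LocallyIntegrable w) (c : ℝ) :
        Continuous fun x => c + ∫ t in (0 : ℝ)..x, w t :=
      continuous_const.add (intervalIntegral.continuous_primitive
        (intervalIntegrable_of_locallyIntegrable hw) 0)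
    exact ((intervalIntegrable_of_locallyIntegrable hu 0 x).mul_continuousOn
      (hcont hw d).continuousOn).add ((intervalIntegrable_of_locallyIntegrable hw
        0 x).continuousOn_mul (hcont hu c).continuousOn)
  apply Complex.ext
  · rw [Complex.add_re, cre hli]
    simp only [Complex.mul_re, Complex.add_re, Complex.add_im, cre h₁, cim h₁, cre h₂, cim h₂]
    rw [mul_primitive_eq_real (hre h₁) (hre h₂), mul_primitive_eq_real (him h₁) (him h₂),
      add_sub_add_comm, ← intervalIntegral.integral_sub (hp (hre h₁) (hre h₂) _ _)
        (hp (him h₁) (him h₂) _ _)]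
    congr 2
    funext t
    ring
  · rw [Complex.add_im, cim hli]
    simp only [Complex.mul_im, Complex.add_re, Complex.add_im, cre h₁, cim h₁, cre h₂, cim h₂]
    rw [mul_primitive_eq_real (hre h₁) (him h₂), mul_primitive_eq_real (him h₁) (hre h₂),
      add_add_add_comm, ← intervalIntegral.integral_add (hp (hre h₁) (him h₂) _ _)
        (hp (him h₁) (hre h₂) _ _)]
    congr 2
    funext t
    ring

/-! ### Functions in `W₂¹(Ω)` as primitives on the two half-lines -/

/-- `u` and `w` are square integrable, and `u` is the primitive of `w` on both half-lines with
boundary values `a` on the left and `b` on the right of the origin. -/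
structure SobolevData (u w : ℝ → ℂ) (a b : ℂ) : Prop where
  memLp : MemLp u 2 volume
  memLp' : MemLp w 2 volume
  left : ∀ᵐ x, x < 0 → u x = a + ∫ t in (0 : ℝ)..x, w t
  right : ∀ᵐ x, 0 < x → u x = b + ∫ t in (0 : ℝ)..x, w t

theorem ae_ne_zero : ∀ᵐ x : ℝ, x ≠ 0 := by simp [ae_iff, measure_singleton]

theorem _root_.MeasureTheory.MemLp.locallyIntegrable_two {w : ℝ → ℂ} (h : MemLp w 2 volume) :
    LocallyIntegrable w :=
  h.locallyIntegrable (by norm_num)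

namespace SobolevData

variable {u w : ℝ → ℂ} {a b : ℂ}

/-- After subtracting the primitive of `w` that vanishes at `0`, what remains of `u` is constant on
each half-line. Testing it against `φ'` gives `a φ(0) - b φ(0)`, and `φ(0) = 0` because the support
of `φ` avoids the origin. -/
theorem hasWeakDeriv (h : SobolevData u w a b) : HasWeakDeriv u w := by
  intro φ hφ hc hs
  have hw := h.memLp'.locallyIntegrable_two
  have hdφ : Continuous (deriv φ) := hφ.continuous_deriv (by simp)
  have hφ1 : ContDiff ℝ 1 φ := hφ.of_le (by simp)
  have h0 : φ 0 = 0 := image_eq_zero_of_notMem_tsupport fun h0 => hs h0 rfl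
  have iW : Integrable fun x => deriv φ x • ∫ t in (0 : ℝ)..x, w t :=
    (hdφ.smul (intervalIntegral.continuous_primitive
      (intervalIntegrable_of_locallyIntegrable hw) 0)).integrable_of_hasCompactSupport
        hc.deriv.smul_right
  have iu : Integrable fun x => deriv φ x • u x :=
    h.memLp.locallyIntegrable_two.integrable_smul_left_of_hasCompactSupport hdφ hc.deriv
  have hi : Integrable fun x => deriv φ x • u x - deriv φ x • ∫ t in (0 : ℝ)..x, w t :=
    iu.sub iW
  have hsub : ∫ x, (deriv φ x • u x - deriv φ x • ∫ t in (0 : ℝ)..x, w t) = _ :=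
    integral_sub iu iW
  rw [← integral_deriv_smul_primitive hw hφ hc, ← sub_eq_zero, ← hsub,
    ← intervalIntegral.integral_Iic_add_Ioi (b := 0) hi.integrableOn hi.integrableOn, integral_Iic_eq_integral_Iio]
  have e1 : ∫ x in Iio (0 : ℝ), (deriv φ x • u x - deriv φ x • ∫ t in (0 : ℝ)..x, w t)
      = ∫ x in Iio (0 : ℝ), deriv φ x • a := by
    refine setIntegral_congr_ae measurableSet_Iio ?_
    filter_upwards [h.left] with x hx hx0
    rw [hx hx0, ← smul_sub, add_sub_cancel_right]
  have e2 : ∫ x in Ioi (0 : ℝ), (deriv φ x • u x - deriv φ x • ∫ t in (0 : ℝ)..x, w t)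
      = ∫ x in Ioi (0 : ℝ), deriv φ x • b := by
    refine setIntegral_congr_ae measurableSet_Ioi ?_
    filter_upwards [h.right] with x hx hx0
    rw [hx hx0, ← smul_sub, add_sub_cancel_right]
  rw [e1, e2, integral_smul_const, integral_smul_const, hc.integral_Ioi_deriv_eq hφ1,
    ← integral_Iic_eq_integral_Iio, hc.integral_Iic_deriv_eq hφ1, h0]
  simp

theorem mem_sobolev (h : SobolevData u w a b) : h.memLp.toLp u ∈ sobolev :=
  ⟨h.memLp'.toLp w, h.hasWeakDeriv.congr h.memLp.coeFn_toLp.symm h.memLp'.coeFn_toLp.symm⟩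

theorem weakDeriv_eq (h : SobolevData u w a b) :
    weakDeriv ⟨h.memLp.toLp u, h.mem_sobolev⟩ = h.memLp'.toLp w :=
  (hasWeakDeriv_weakDeriv _).unique
    (h.hasWeakDeriv.congr h.memLp.coeFn_toLp.symm h.memLp'.coeFn_toLp.symm)

theorem leftValue_eq (h : SobolevData u w a b) : leftValue (h.memLp.toLp u) = a := by
  refine tendsto_nhds_unique (tendsto_leftValue h.mem_sobolev) ?_
  have := ((continuous_primitive h.memLp'.locallyIntegrable_two a).tendsto 0).mono_left
    (inf_le_left.trans nhdsWithin_le_nhds : 𝓝[<] (0 : ℝ) ⊓ ae volume ≤ 𝓝 0)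
  rw [intervalIntegral.integral_same, add_zero] at this
  refine this.congr' ?_
  filter_upwards [mem_inf_of_right h.left, mem_inf_of_right h.memLp.coeFn_toLp,
    mem_inf_of_left self_mem_nhdsWithin] with x hx e hxs
  rw [e, hx hxs]

theorem rightValue_eq (h : SobolevData u w a b) : rightValue (h.memLp.toLp u) = b := by
  refine tendsto_nhds_unique (tendsto_rightValue h.mem_sobolev) ?_
  have := ((continuous_primitive h.memLp'.locallyIntegrable_two b).tendsto 0).mono_left
    (inf_le_left.trans nhdsWithin_le_nhds : 𝓝[>] (0 : ℝ) ⊓ ae volume ≤ 𝓝 0)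
  rw [intervalIntegral.integral_same, add_zero] at this
  refine this.congr' ?_
  filter_upwards [mem_inf_of_right h.right, mem_inf_of_right h.memLp.coeFn_toLp,
    mem_inf_of_left self_mem_nhdsWithin] with x hx e hxs
  rw [e, hx hxs]

/-- Together with `mem_sobolev` this identifies `W₂¹(Ω)` with the functions described by
`SobolevData`; the integration constants are the boundary values, by continuity of the primitive. -/
theorem of_sobolev (ψ : sobolev) : SobolevData (ψ : L2R) (weakDeriv ψ)
    (leftValue (ψ : L2R)) (rightValue (ψ : L2R)) := by
  have hw := hasWeakDeriv_weakDeriv ψ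
  obtain ⟨c, hc⟩ := hw.exists_ae_eq isOpen_Iio ordConnected_Iio
    (p := -1) (by simp : (-1 : ℝ) ∈ Iio (0 : ℝ)) (by simp)
  obtain ⟨d, hd⟩ := hw.exists_ae_eq isOpen_Ioi ordConnected_Ioi
    (p := 1) (by simp : (1 : ℝ) ∈ Ioi (0 : ℝ)) (by simp)
  have h : SobolevData (ψ : L2R) (weakDeriv ψ) c d :=
    ⟨Lp.memLp _, Lp.memLp _, hc, hd⟩
  have e1 := h.leftValue_eq
  have e2 := h.rightValue_eq
  rw [Lp.toLp_coeFn] at e1 e2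
  rwa [e1, e2]

end SobolevData

/-! ### Integration by parts on the punctured line -/

theorem integral_Ioi_mul_primitive {u₁ u₂ w₁ w₂ : ℝ → ℂ} {b₁ b₂ : ℂ}
    (hu₁ : MemLp u₁ 2 volume) (hu₂ : MemLp u₂ 2 volume) (hw₁ : MemLp w₁ 2 volume)
    (hw₂ : MemLp w₂ 2 volume)
    (h₁ : ∀ᵐ x, 0 < x → u₁ x = b₁ + ∫ t in (0 : ℝ)..x, w₁ t)
    (h₂ : ∀ᵐ x, 0 < x → u₂ x = b₂ + ∫ t in (0 : ℝ)..x, w₂ t) :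
    ∫ x in Ioi (0 : ℝ), (w₁ x * u₂ x + u₁ x * w₂ x) = -(b₁ * b₂) := by
  have l₁ := hw₁.locallyIntegrable_two
  have l₂ := hw₂.locallyIntegrable_two
  have hi : Integrable fun x => w₁ x * u₂ x + u₁ x * w₂ x :=
    (hw₁.integrable_mul hu₂).add (hu₁.integrable_mul hw₂)
  have hlim := intervalIntegral_tendsto_integral_Ioi 0 hi.integrableOn tendsto_id
  set I := ∫ x in Ioi (0 : ℝ), (w₁ x * u₂ x + u₁ x * w₂ x)
  have hprod (R : ℝ) (hR : 0 < R) : ∫ x in (0 : ℝ)..R, (w₁ x * u₂ x + u₁ x * w₂ x) =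
      (b₁ + ∫ t in (0 : ℝ)..R, w₁ t) * (b₂ + ∫ t in (0 : ℝ)..R, w₂ t) - b₁ * b₂ := by
    rw [mul_primitive_eq l₁ l₂, add_sub_cancel_left]
    refine intervalIntegral.integral_congr_ae ?_
    filter_upwards [h₁, h₂] with x e₁ e₂ hx
    rw [uIoc_of_le hR.le] at hx
    rw [e₁ hx.1, e₂ hx.1]
  have hlim2 : Tendsto (fun R : ℝ => (b₁ + ∫ t in (0 : ℝ)..R, w₁ t) *
      (b₂ + ∫ t in (0 : ℝ)..R, w₂ t)) atTop (𝓝 (I + b₁ * b₂)) := by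
    refine (hlim.add_const (b₁ * b₂)).congr' ?_
    filter_upwards [eventually_gt_atTop 0] with R hR
    rw [id, hprod R hR, sub_add_cancel]
  have hint : IntegrableOn (fun R : ℝ => (b₁ + ∫ t in (0 : ℝ)..R, w₁ t) *
      (b₂ + ∫ t in (0 : ℝ)..R, w₂ t)) (Ioi 0) := by
    refine (hu₁.integrable_mul hu₂).integrableOn.congr_fun_ae ?_
    rw [EventuallyEq, ae_restrict_iff' measurableSet_Ioi]
    filter_upwards [h₁, h₂] with x e₁ e₂ hx
    rw [Pi.mul_apply, e₁ hx, e₂ hx]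
  -- No boundary term comes from infinity: the product has a limit there because its derivative is
  -- integrable, and the limit is `0` because the product is itself integrable while every
  -- neighbourhood of infinity has infinite measure.
  have h0 : I + b₁ * b₂ = 0 :=
    IntegrableAtFilter.eq_zero_of_tendsto (μ := volume) (l := atTop)
      ⟨Ioi 0, Ioi_mem_atTop 0, hint⟩ (fun s hs => by
        obtain ⟨M, hM⟩ := mem_atTop_sets.1 hs
        exact top_unique (Real.volume_Ici (a := M) ▸ measure_mono hM)) hlim2
  exact eq_neg_of_add_eq_zero_left h0

theorem SobolevData.integral_Ioi {u₁ u₂ w₁ w₂ : ℝ → ℂ} {a₁ a₂ b₁ b₂ : ℂ}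
    (h₁ : SobolevData u₁ w₁ a₁ b₁) (h₂ : SobolevData u₂ w₂ a₂ b₂) :
    ∫ x in Ioi (0 : ℝ), (w₁ x * u₂ x + u₁ x * w₂ x) = -(b₁ * b₂) :=
  integral_Ioi_mul_primitive h₁.memLp h₂.memLp h₁.memLp' h₂.memLp' h₁.right h₂.right

/-- Transfers the formula on the right half-line to the left one. -/
theorem SobolevData.reflect {u w : ℝ → ℂ} {a b : ℂ} (h : SobolevData u w a b) :
    SobolevData (fun x => u (-x)) (fun x => -w (-x)) b a := by
  have hq := (Measure.measurePreserving_neg (volume : Measure ℝ))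
  have hp (x : ℝ) : ∫ t in (0 : ℝ)..x, -w (-t) = ∫ t in (0 : ℝ)..(-x), w t := by
    rw [intervalIntegral.integral_neg, intervalIntegral.integral_comp_neg (f := w), neg_zero,
      intervalIntegral.integral_symm, neg_neg]
  refine ⟨h.memLp.comp_measurePreserving hq, (h.memLp'.comp_measurePreserving hq).neg, ?_, ?_⟩
  · filter_upwards [hq.quasiMeasurePreserving.ae h.right] with x hx hx0
    rw [hx (by linarith), hp]
  · filter_upwards [hq.quasiMeasurePreserving.ae h.left] with x hx hx0
    rw [hx (by linarith), hp]

theorem SobolevData.conj {u w : ℝ → ℂ} {a b : ℂ} (h : SobolevData u w a b) :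
    SobolevData (fun x => conj (u x)) (fun x => conj (w x)) (conj a) (conj b) := by
  have hp (x : ℝ) : ∫ t in (0 : ℝ)..x, conj (w t) = conj (∫ t in (0 : ℝ)..x, w t) := by
    rw [intervalIntegral, intervalIntegral, integral_conj, integral_conj, map_sub]
  refine ⟨h.memLp.star, h.memLp'.star, ?_, ?_⟩
  · filter_upwards [h.left] with x hx hx0
    rw [hx hx0, hp, map_add]
  · filter_upwards [h.right] with x hx hx0
    rw [hx hx0, hp, map_add]

theorem SobolevData.integral_Iic {u₁ u₂ w₁ w₂ : ℝ → ℂ} {a₁ a₂ b₁ b₂ : ℂ}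
    (h₁ : SobolevData u₁ w₁ a₁ b₁) (h₂ : SobolevData u₂ w₂ a₂ b₂) :
    ∫ x in Iic (0 : ℝ), (w₁ x * u₂ x + u₁ x * w₂ x) = a₁ * a₂ := by
  have := h₁.reflect.integral_Ioi h₂.reflect
  rw [← neg_inj, ← this, ← integral_neg, ← neg_zero, ← integral_comp_neg_Ioi, neg_zero]
  congr 1
  funext x
  ring

theorem integral_by_parts (ψ φ : sobolev) :
    pairing (weakDeriv ψ) (φ : L2R) + pairing (ψ : L2R) (weakDeriv φ) =
      leftValue (ψ : L2R) * conj (leftValue (φ : L2R)) -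
        rightValue (ψ : L2R) * conj (rightValue (φ : L2R)) := by
  have hψ := SobolevData.of_sobolev ψ
  have hφ := (SobolevData.of_sobolev φ).conj
  have i1 : Integrable fun x => weakDeriv ψ x * conj ((φ : L2R) x) :=
    hψ.memLp'.integrable_mul hφ.memLp
  have i2 : Integrable fun x => (ψ : L2R) x * conj (weakDeriv φ x) :=
    hψ.memLp.integrable_mul hφ.memLp'
  have hi : Integrable fun x => weakDeriv ψ x * conj ((φ : L2R) x) +
      (ψ : L2R) x * conj (weakDeriv φ x) := i1.add i2
  have hadd : ∫ x, (weakDeriv ψ x * conj ((φ : L2R) x) + (ψ : L2R) x * conj (weakDeriv φ x)) = _ :=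
    integral_add i1 i2
  rw [pairing, pairing, ← hadd,
    ← intervalIntegral.integral_Iic_add_Ioi (b := 0) hi.integrableOn hi.integrableOn]
  exact (congrArg₂ (· + ·) (hψ.integral_Iic hφ) (hψ.integral_Ioi hφ)).trans (by ring)

/-! ### Symmetric operators with surjective `A - z` -/

section Symmetric

variable {H : Type*} [NormedAddCommGroup H] [InnerProductSpace ℂ H]

/-- By symmetry `⟨ψ, Aψ⟩` is real, so the imaginary part of `⟨ψ, (A - z)ψ⟩` is `-Im z ‖ψ‖²`;
Cauchy–Schwarz does the rest. -/
theorem _root_.LinearPMap.IsFormalAdjoint.abs_im_mul_norm_le {A : H →ₗ.[ℂ] H}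
    (hA : A.IsFormalAdjoint A) (z : ℂ) (ψ : A.domain) :
    |z.im| * ‖(ψ : H)‖ ≤ ‖A ψ - z • (ψ : H)‖ := by
  have h1 : (inner ℂ (ψ : H) (A ψ)).im = 0 := by
    rw [← Complex.conj_eq_iff_im, inner_conj_symm, hA]
  have h2 : (inner ℂ (ψ : H) (A ψ - z • (ψ : H))).im = -(z.im * ‖(ψ : H)‖ ^ 2) := by
    rw [inner_sub_right, inner_smul_right, inner_self_eq_norm_sq_to_K, Complex.sub_im, h1]
    simp [← Complex.ofReal_pow]
  have h3 : |z.im| * ‖(ψ : H)‖ ^ 2 ≤ ‖(ψ : H)‖ * ‖A ψ - z • (ψ : H)‖ := by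
    rw [← abs_of_nonneg (sq_nonneg ‖(ψ : H)‖), ← abs_mul, ← abs_neg, ← h2]
    exact (Complex.abs_im_le_norm _).trans (norm_inner_le_norm _ _)
  rcases (norm_nonneg (ψ : H)).eq_or_lt with h0 | h0
  · rw [← h0, mul_zero]
    exact norm_nonneg _
  · refine le_of_mul_le_mul_left ?_ h0
    linarith [h3]

theorem _root_.LinearPMap.IsFormalAdjoint.eq_zero {A : H →ₗ.[ℂ] H}
    (hA : A.IsFormalAdjoint A) {z : ℂ} (hz : z.im ≠ 0) (ψ : A.domain)
    (h : A ψ - z • (ψ : H) = 0) : (ψ : H) = 0 := by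
  have := hA.abs_im_mul_norm_le z ψ
  rw [h, norm_zero] at this
  exact norm_le_zero_iff.1 (nonpos_of_mul_nonpos_right this (abs_pos.2 hz))

/-- Density of the domain is not assumed; it follows from surjectivity at `±i`, as does the
inclusion of the domain of the adjoint in that of `A`. -/
theorem _root_.LinearPMap.IsFormalAdjoint.isSelfAdjoint [CompleteSpace H] {A : H →ₗ.[ℂ] H}
    (hA : A.IsFormalAdjoint A) (h : ∀ z : ℂ, z.im ≠ 0 → ∀ h : H, ∃ ψ : A.domain,
      A ψ - z • (ψ : H) = h) : IsSelfAdjoint A := by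
  have hI : Complex.I.im ≠ 0 := by simp
  have hI' : (-Complex.I).im ≠ 0 := by simp
  have hd : Dense (A.domain : Set H) := by
    rw [Submodule.dense_iff_topologicalClosure_eq_top, Submodule.topologicalClosure_eq_top_iff,
      Submodule.eq_bot_iff]
    intro u hu
    obtain ⟨ψ, rfl⟩ := h _ hI u
    -- With `u = (A - i)ψ` orthogonal to the domain and `ψ = (A + i)φ`, one has `0 = ⟨u, φ⟩ = ⟨ψ, (A
    -- + i)φ⟩ = ‖ψ‖²`.
    have h0 : (ψ : H) = 0 := by
      obtain ⟨φ, hφ⟩ := h _ hI' (ψ : H)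
      have := (Submodule.mem_orthogonal' _ _).1 hu φ φ.2
      rw [inner_sub_left, hA, inner_smul_left, Complex.conj_I, ← inner_smul_right,
        ← inner_sub_right, hφ] at this
      exact inner_self_eq_zero.1 this
    have : ψ = 0 := Subtype.ext h0
    simp [this]
  rw [LinearPMap.isSelfAdjoint_def]
  refine (LinearPMap.eq_of_le_of_domain_eq (hA.le_adjoint hd) (le_antisymm
    (hA.le_adjoint hd).1 fun y hy => ?_)).symm
  obtain ⟨ψ, hψ⟩ := h _ hI (A.adjoint ⟨y, hy⟩ - Complex.I • y)
  obtain ⟨φ, hφ⟩ := h _ hI' (y - ψ)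
  -- Since `(A* - i)y = (A - i)ψ`, the vector `y - ψ` is orthogonal to the range of `A + i`, and `y
  -- - ψ = (A + i)φ` lies in that range.
  have e : inner ℂ (y - ψ) (y - ψ) = 0 := by
    nth_rw 2 [← hφ]
    have e1 := LinearPMap.adjoint_isFormalAdjoint hd ⟨y, hy⟩ φ
    rw [inner_sub_left, inner_sub_right, inner_sub_right, ← e1, ← hA, inner_smul_right,
      inner_smul_right, sub_eq_iff_eq_add.1 hψ, inner_add_left, inner_sub_left,
      inner_smul_left, inner_smul_left]
    simp only [Complex.conj_I]
    ring
  rw [sub_eq_zero.1 (inner_self_eq_zero.1 e)]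
  exact ψ.2

end Symmetric

/-- Chosen preimages under `A - z` depend linearly on the datum because `A - z` is injective, and
the lower bound for `A - z` makes the inverse continuous. -/
theorem exists_isResolvent {A : L2R →ₗ.[ℂ] L2R} (hA : A.IsFormalAdjoint A) {z : ℂ}
    (hz : z.im ≠ 0) (h : ∀ h : L2R, ∃ ψ : A.domain, A ψ - z • (ψ : L2R) = h) :
    ∃ R : L2R →L[ℂ] L2R, IsResolvent A z R := by
  have inj {ψ φ : A.domain} (e : A ψ - z • (ψ : L2R) = A φ - z • (φ : L2R)) :
      (ψ : L2R) = φ := by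
    rw [← sub_eq_zero, ← Submodule.coe_sub]
    refine hA.eq_zero hz _ ?_
    rw [LinearPMap.map_sub, Submodule.coe_sub, smul_sub, sub_sub_sub_comm, e, sub_self]
  choose r hr using h
  refine ⟨LinearMap.mkContinuous
    { toFun := fun u => (r u : L2R)
      map_add' := fun u w => by
        rw [← Submodule.coe_add]
        refine inj ?_
        rw [hr, LinearPMap.map_add, Submodule.coe_add, smul_add, add_sub_add_comm, hr, hr]
      map_smul' := fun c u => by
        rw [RingHom.id_apply, ← Submodule.coe_smul]
        refine inj ?_
        rw [hr, LinearPMap.map_smul, Submodule.coe_smul, smul_comm, ← smul_sub, hr] }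
    |z.im|⁻¹ fun u => ?_, fun u => ⟨(r u).2, hr u⟩, fun ψ => inj (hr _)⟩
  rw [inv_mul_eq_div, le_div_iff₀' (abs_pos.2 hz)]
  exact (hA.abs_im_mul_norm_le z (r u)).trans_eq (by rw [hr])

/-! ### Symmetry of the nonlocal operator -/

theorem mem_nonlocalOp_domain {v₁ v₂ : L2R} {α : ℝ} {ψ : L2R} :
    ψ ∈ (nonlocalOp v₁ v₂ α).domain ↔ ψ ∈ bcDomain v₁ v₂ α :=
  ⟨fun h => h.1, fun h => ⟨h, h.1⟩⟩

theorem nonlocalOp_apply {v₁ v₂ : L2R} {α : ℝ} (ψ : (nonlocalOp v₁ v₂ α).domain) :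
    nonlocalOp v₁ v₂ α ψ = Complex.I • weakDeriv ⟨ψ, ψ.2.2⟩
        + (leftValue (ψ : L2R) + Complex.I / 2 * pairing (ψ : L2R) v₁) • v₁
        + (rightValue (ψ : L2R) - Complex.I / 2 * pairing (ψ : L2R) v₂) • v₂ := rfl

/-- The coefficients `i/2` complete the boundary form to `i (L conj L' - R conj R')`, where `L =
ψ(-0) + i⟨ψ, v₁⟩`, `R = ψ(+0) - i⟨ψ, v₂⟩` and primes refer to `φ`. The boundary condition says that
`R` is `e^{iα} L`, and `|e^{iα}| = 1`. -/
theorem nonlocalOp_isFormalAdjoint (v₁ v₂ : L2R) (α : ℝ) :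
    (nonlocalOp v₁ v₂ α).IsFormalAdjoint (nonlocalOp v₁ v₂ α) := by
  intro φ ψ
  have hibp := integral_by_parts ⟨ψ, ψ.2.2⟩ ⟨φ, φ.2.2⟩
  have hψ := ψ.2.1.2
  have hφ := congrArg conj φ.2.1.2
  have he : Complex.exp (Complex.I * α) * conj (Complex.exp (Complex.I * α)) = 1 := by
    rw [← Complex.exp_conj, ← Complex.exp_add]
    simp
  rw [nonlocalOp_apply, nonlocalOp_apply]
  simp only [pairing_eq_inner, inner_add_left, inner_add_right, inner_smul_left,
    inner_smul_right, map_add, map_sub, map_mul, map_div₀, Complex.conj_I, Complex.conj_ofNat,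
    inner_conj_symm] at hψ hφ hibp ⊢
  generalize weakDeriv _ = ψ' at hibp ⊢
  generalize weakDeriv _ = φ' at hibp ⊢
  generalize Complex.exp (Complex.I * α) = e at *
  linear_combination (-Complex.I) * hibp
    + Complex.I * (conj (rightValue (φ : L2R)) + Complex.I * inner ℂ (φ : L2R) v₂) * hψ
    + Complex.I * (e * (leftValue (ψ : L2R) + Complex.I * inner ℂ v₁ (ψ : L2R))) * hφ
    + Complex.I * (leftValue (ψ : L2R) + Complex.I * inner ℂ v₁ (ψ : L2R))
      * (conj (leftValue (φ : L2R)) - Complex.I * inner ℂ (φ : L2R) v₁) * he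
    - (rightValue (ψ : L2R) * inner ℂ (φ : L2R) v₂
      - inner ℂ v₂ (ψ : L2R) * conj (rightValue (φ : L2R))
      - Complex.I * inner ℂ v₂ (ψ : L2R) * inner ℂ (φ : L2R) v₂
      + leftValue (ψ : L2R) * inner ℂ (φ : L2R) v₁
      - inner ℂ v₁ (ψ : L2R) * conj (leftValue (φ : L2R))
      + Complex.I * inner ℂ v₁ (ψ : L2R) * inner ℂ (φ : L2R) v₁) * Complex.I_sq

/-! ### Integral operators with exponentially decaying kernels -/

theorem integrable_exp_neg_mul_abs {η : ℝ} (hη : 0 < η) :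
    Integrable fun x : ℝ => Real.exp (-η * |x|) := by
  rw [← integrableOn_univ, ← Iic_union_Ioi (a := (0 : ℝ)), integrableOn_union]
  constructor
  · refine (integrableOn_exp_mul_Iic hη 0).congr_fun (fun x hx => ?_) measurableSet_Iic
    simp only [abs_of_nonpos (mem_Iic.1 hx), mul_neg, neg_mul, neg_neg]
  · refine (exp_neg_integrableOn_Ioi 0 hη).congr_fun (fun x hx => ?_) measurableSet_Ioi
    simp only [abs_of_pos (mem_Ioi.1 hx)]

theorem memLp_exp_neg_mul_abs {η : ℝ} (hη : 0 < η) :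
    MemLp (fun x : ℝ => Real.exp (-η * |x|)) 2 volume := by
  rw [memLp_two_iff_integrable_sq (by fun_prop)]
  refine (integrable_exp_neg_mul_abs (mul_pos two_pos hη)).congr (ae_of_all _ fun x => ?_)
  simp only [← Real.exp_nat_mul]
  congr 1
  push_cast
  ring

/-- Schur's test: split the convolution bound into two equal factors, apply Cauchy–Schwarz in `y`,
then integrate in `x` with Tonelli. -/
theorem memLp_integral_mul_of_exp_decay {K : ℝ → ℝ → ℂ} {C η : ℝ} (hη : 0 < η)
    (hK : StronglyMeasurable (Function.uncurry K))
    (hb : ∀ x y, ‖K x y‖ ≤ C * Real.exp (-η * |x - y|)) (h : L2R) :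
    MemLp (fun x => ∫ y, K x y * h y) 2 volume := by
  have hm : StronglyMeasurable fun x => ∫ y, K x y * h y :=
    StronglyMeasurable.integral_prod_right (f := fun x y => K x y * h y)
      (hK.mul ((Lp.stronglyMeasurable h).comp_measurable measurable_snd))
  refine ⟨hm.aestronglyMeasurable, ?_⟩
  rw [eLpNorm_lt_top_iff_lintegral_rpow_enorm_lt_top (by simp) (by simp)]
  -- The square root of the decay factor, so that one copy of `s` stays with `h` and the other is
  -- integrated alone.
  set s : ℝ → ENNReal := fun x => ENNReal.ofReal (Real.exp (-(η / 2) * |x|)) with hs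
  have hsm : Measurable s := by
    rw [hs]
    fun_prop
  have hhm : Measurable fun y => ‖h y‖ₑ := (Lp.stronglyMeasurable h).measurable.enorm
  have hss (x : ℝ) : s x * s x = ENNReal.ofReal (Real.exp (-η * |x|)) := by
    rw [hs, ← ENNReal.ofReal_mul (Real.exp_pos _).le, ← Real.exp_add]
    ring_nf
  set A : ENNReal := ∫⁻ x, s x * s x with hA
  have hAt : A < ⊤ := by
    simp_rw [hA, hss]
    exact (integrable_exp_neg_mul_abs hη).lintegral_lt_top
  have hC : 0 ≤ C := by
    have := (norm_nonneg _).trans (hb 0 0)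
    simpa using this
  set B : ENNReal := ∫⁻ y, ‖h y‖ₑ ^ (2 : ℝ) with hB
  have hBt : B < ⊤ := by
    have := lintegral_rpow_enorm_lt_top_of_eLpNorm_lt_top (by simp) (by simp)
      (Lp.memLp h).eLpNorm_lt_top
    simpa [hB] using this
  have hrp (t : ENNReal) : t ^ (2 : ℝ) = t * t := by
    rw [ENNReal.rpow_ofNat, sq]
  have hpt (x : ℝ) : ‖∫ y, K x y * h y‖ₑ ^ (2 : ℝ) ≤ ENNReal.ofReal C ^ (2 : ℝ) *
      (A * ∫⁻ y, s (x - y) * s (x - y) * ‖h y‖ₑ ^ (2 : ℝ)) := by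
    have h1 : ‖∫ y, K x y * h y‖ₑ ≤ ENNReal.ofReal C * ∫⁻ y, s (x - y) * (s (x - y) * ‖h y‖ₑ) := by
      refine (enorm_integral_le_lintegral_enorm _).trans ?_
      rw [← lintegral_const_mul _ (by fun_prop)]
      refine lintegral_mono fun y => ?_
      rw [enorm_mul, ← mul_assoc (s _), hss, ← mul_assoc, ← ENNReal.ofReal_mul hC,
        ← ofReal_norm]
      gcongr
      exact hb x y
    have h2 := ENNReal.lintegral_mul_le_Lp_mul_Lq volume Real.HolderConjugate.two_two
      (f := fun y => s (x - y)) (g := fun y => s (x - y) * ‖h y‖ₑ) (by fun_prop) (by fun_prop)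
    have h3 : ∫⁻ y, s (x - y) ^ (2 : ℝ) = A := by
      simp_rw [hrp, hA]
      exact lintegral_sub_left_eq_self (fun y => s y * s y) x
    have h4 : ∫⁻ y, (s (x - y) * ‖h y‖ₑ) ^ (2 : ℝ) =
        ∫⁻ y, s (x - y) * s (x - y) * ‖h y‖ₑ ^ (2 : ℝ) := by
      refine lintegral_congr fun y => ?_
      rw [ENNReal.mul_rpow_of_nonneg _ _ two_pos.le, hrp (s _)]
    rw [h3, h4] at h2
    refine (ENNReal.rpow_le_rpow (h1.trans (mul_le_mul_right h2 _)) two_pos.le).trans_eq ?_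
    rw [ENNReal.mul_rpow_of_nonneg _ _ two_pos.le, ENNReal.mul_rpow_of_nonneg _ _ two_pos.le,
      ← ENNReal.rpow_mul, ← ENNReal.rpow_mul]
    norm_num
  have hint : ∫⁻ x, ∫⁻ y, s (x - y) * s (x - y) * ‖h y‖ₑ ^ (2 : ℝ) = A * B := by
    rw [lintegral_lintegral_swap (by fun_prop), hB, ← lintegral_const_mul _ (by fun_prop)]
    refine lintegral_congr fun y => ?_
    rw [lintegral_mul_const _ (by fun_prop), lintegral_sub_right_eq_self (fun x => s x * s x) y]
  have h2 : (2 : ENNReal).toReal = 2 := by simp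
  rw [h2]
  refine (lintegral_mono hpt).trans_lt ?_
  have hm2 : Measurable fun x => ∫⁻ y, s (x - y) * s (x - y) * ‖h y‖ₑ ^ (2 : ℝ) :=
    Measurable.lintegral_prod_right'
      (f := fun p : ℝ × ℝ => s (p.1 - p.2) * s (p.1 - p.2) * ‖h p.2‖ₑ ^ (2 : ℝ)) (by fun_prop)
  rw [lintegral_const_mul _ (hm2.const_mul _), lintegral_const_mul _ hm2, hint]
  have : ENNReal.ofReal C ^ (2 : ℝ) < ⊤ := ENNReal.rpow_lt_top_of_nonneg two_pos.le (by simp)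
  exact ENNReal.mul_lt_top this (ENNReal.mul_lt_top hAt (ENNReal.mul_lt_top hAt hBt))

/-! ### Measurability and decay of the point-interaction Green function -/

theorem measurable_heaviside : Measurable heaviside :=
  Measurable.ite measurableSet_Ioi measurable_const measurable_const

theorem measurable_freeGreen (z : ℂ) : Measurable (freeGreen z) := by
  have := measurable_heaviside
  unfold freeGreen
  fun_prop

theorem stronglyMeasurable_pointGreen (α : ℝ) (z : ℂ) :
    StronglyMeasurable (Function.uncurry (pointGreen α z)) := by
  have h1 := measurable_freeGreen z
  have h2 := measurable_freeGreen (conj z)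
  have : Measurable fun p : ℝ × ℝ => freeGreen z (p.1 - p.2) +
      freeGreen z p.1 * beta z α * conj (freeGreen (conj z) p.2) := by
    fun_prop
  exact this.stronglyMeasurable

theorem freeGreen_of_pos {z : ℂ} (hz : 0 < z.im) (x : ℝ) :
    freeGreen z x = if x < 0 then Complex.I * Complex.exp (-Complex.I * z * x) else 0 := by
  have : 0 < -x * z.im ↔ x < 0 := by
    rw [mul_pos_iff_of_pos_right hz, neg_pos]
  simp only [freeGreen, heaviside, this, Real.sign_of_pos hz]
  split_ifs <;> simp

theorem freeGreen_of_neg {z : ℂ} (hz : z.im < 0) (x : ℝ) :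
    freeGreen z x = if 0 < x then -Complex.I * Complex.exp (-Complex.I * z * x) else 0 := by
  have : 0 < -x * z.im ↔ 0 < x := by
    rw [neg_mul, ← mul_neg, mul_pos_iff_of_pos_right (neg_pos.2 hz)]
  simp only [freeGreen, heaviside, this, Real.sign_of_neg hz]
  split_ifs <;> simp

theorem norm_exp_neg_I_mul (z : ℂ) (x : ℝ) :
    ‖Complex.exp (-Complex.I * z * x)‖ = Real.exp (z.im * x) := by
  rw [Complex.norm_exp]
  simp

theorem norm_freeGreen_le {z : ℂ} (hz : z.im ≠ 0) (x : ℝ) :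
    ‖freeGreen z x‖ ≤ Real.exp (-|z.im| * |x|) := by
  rcases hz.lt_or_gt with hz | hz
  · rw [freeGreen_of_neg hz]
    split_ifs with h
    · rw [norm_mul, norm_exp_neg_I_mul, abs_of_neg hz, abs_of_pos h]
      simp
    · simpa using (Real.exp_pos _).le
  · rw [freeGreen_of_pos hz]
    split_ifs with h
    · rw [norm_mul, norm_exp_neg_I_mul, abs_of_pos hz, abs_of_neg h]
      simp
    · simpa using (Real.exp_pos _).le

theorem norm_exp_I_mul_ofReal (α : ℝ) : ‖Complex.exp (Complex.I * α)‖ = 1 := by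
  rw [mul_comm, Complex.norm_exp_ofReal_mul_I]

theorem norm_pointGreen_le (α : ℝ) {z : ℂ} (hz : z.im ≠ 0) (x y : ℝ) :
    ‖pointGreen α z x y‖ ≤ (1 + ‖beta z α‖) * Real.exp (-|z.im| * |x - y|) := by
  have hz' : (conj z).im ≠ 0 := by simpa using hz
  have h2 := norm_freeGreen_le hz' y
  rw [Complex.conj_im, abs_neg] at h2
  have h3 : Real.exp (-|z.im| * |x|) * Real.exp (-|z.im| * |y|) ≤
      Real.exp (-|z.im| * |x - y|) := by
    rw [← Real.exp_add, Real.exp_le_exp]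
    nlinarith [abs_sub x y, abs_nonneg z.im]
  refine (norm_add_le _ _).trans ?_
  rw [norm_mul, norm_mul, RCLike.norm_conj, add_mul, one_mul]
  refine add_le_add (norm_freeGreen_le hz _) ?_
  calc ‖freeGreen z x‖ * ‖beta z α‖ * ‖freeGreen (conj z) y‖
      ≤ Real.exp (-|z.im| * |x|) * ‖beta z α‖ * Real.exp (-|z.im| * |y|) := by
        gcongr
        exact norm_freeGreen_le hz x
    _ = ‖beta z α‖ * (Real.exp (-|z.im| * |x|) * Real.exp (-|z.im| * |y|)) := by ring
    _ ≤ _ := by gcongr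

theorem memLp_pointGreen (α : ℝ) {z : ℂ} (hz : z.im ≠ 0) (x : ℝ) :
    MemLp (pointGreen α z x) 2 volume := by
  have h1 := (memLp_exp_neg_mul_abs (abs_pos.2 hz)).comp_measurePreserving
    (Measure.measurePreserving_sub_left (volume : Measure ℝ) x)
  refine h1.of_le_mul (c := 1 + ‖beta z α‖)
    ((stronglyMeasurable_pointGreen α z).of_uncurry_left.aestronglyMeasurable)
    (ae_of_all _ fun y => ?_)
  rw [Function.comp_apply, Real.norm_of_nonneg (Real.exp_pos _).le]
  exact norm_pointGreen_le α hz x y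

theorem integrable_pointGreen_mul (α : ℝ) {z : ℂ} (hz : z.im ≠ 0) (v : L2R) (x : ℝ) :
    Integrable fun y => pointGreen α z x y * v y :=
  (memLp_pointGreen α hz x).integrable_mul (Lp.memLp v)

theorem memLp_greenPotential (α : ℝ) {z : ℂ} (hz : z.im ≠ 0) (v : L2R) :
    MemLp (greenPotential α v z) 2 volume :=
  memLp_integral_mul_of_exp_decay (abs_pos.2 hz) (stronglyMeasurable_pointGreen α z)
    (norm_pointGreen_le α hz) v

/-! ### Explicit solutions of `i u' - z u = h` -/

/-- The solution of `i u' - z u = h` on `ℝ` with value `i C` at the origin. -/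
noncomputable def odeSolution (z : ℂ) (h : ℝ → ℂ) (C : ℂ) (x : ℝ) : ℂ :=
  Complex.I * Complex.exp (-Complex.I * z * x) *
    (C - ∫ y in (0 : ℝ)..x, Complex.exp (Complex.I * z * y) * h y)

theorem odeSolution_eq_primitive (z : ℂ) {h : ℝ → ℂ} (hh : LocallyIntegrable h) (C : ℂ) (x : ℝ) :
    odeSolution z h C x = Complex.I * C +
      ∫ t in (0 : ℝ)..x, (-Complex.I * z * odeSolution z h C t - Complex.I * h t) := by
  have hc1 : Continuous fun x : ℝ => -Complex.I * z * Complex.exp (-Complex.I * z * x) := by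
    fun_prop
  have hc2 : Continuous fun x : ℝ => -Complex.exp (Complex.I * z * x) := by fun_prop
  have h1 (x : ℝ) : 1 + ∫ t in (0 : ℝ)..x, -Complex.I * z * Complex.exp (-Complex.I * z * t) =
      Complex.exp (-Complex.I * z * x) := by
    rw [intervalIntegral.integral_eq_sub_of_hasDerivAt
      (f := fun t : ℝ => Complex.exp (-Complex.I * z * t)) (fun t _ => ?_)
      (hc1.intervalIntegrable _ _)]
    · simp
    · have := ((hasDerivAt_id (t : ℂ)).const_mul (-Complex.I * z)).cexp.comp_ofReal
      simpa [mul_comm] using this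
  have h2 (x : ℝ) : C + ∫ t in (0 : ℝ)..x, h t * -Complex.exp (Complex.I * z * t) =
      C - ∫ t in (0 : ℝ)..x, Complex.exp (Complex.I * z * t) * h t := by
    rw [sub_eq_add_neg, ← intervalIntegral.integral_neg]
    congr 2
    funext t
    ring
  have key := mul_primitive_eq hc1.locallyIntegrable
    (locallyIntegrable_mul_continuous hh hc2) 1 C x
  simp only [h1, h2] at key
  rw [odeSolution, mul_assoc, key, mul_add, one_mul, ← intervalIntegral.integral_const_mul]
  congr 2
  funext t
  have : Complex.exp (-Complex.I * z * t) * Complex.exp (Complex.I * z * t) = 1 := by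
    rw [← Complex.exp_add]
    simp
  rw [odeSolution]
  linear_combination (-Complex.I * h t) * this

theorem SobolevData.of_odeSolution {z : ℂ} {u h : ℝ → ℂ} {C D : ℂ} (hu : MemLp u 2 volume)
    (hh : MemLp h 2 volume) (hl : ∀ x < 0, u x = odeSolution z h C x)
    (hr : ∀ x, 0 < x → u x = odeSolution z h D x) :
    SobolevData u (fun x => -Complex.I * z * u x - Complex.I * h x)
      (Complex.I * C) (Complex.I * D) := by
  refine ⟨hu, (hu.const_mul _).sub (hh.const_mul _), ae_of_all _ fun x hx => ?_,
    ae_of_all _ fun x hx => ?_⟩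
  · rw [hl x hx, odeSolution_eq_primitive z hh.locallyIntegrable_two]
    congr 1
    refine intervalIntegral.integral_congr_ae ?_
    -- The interval of integration contains `0`, where nothing is known about `u`; this point is a
    -- null set.
    filter_upwards [ae_ne_zero] with t ht0 ht
    rw [uIoc_of_ge hx.le] at ht
    rw [hl t (lt_of_le_of_ne ht.2 ht0)]
  · rw [hr x hx, odeSolution_eq_primitive z hh.locallyIntegrable_two]
    congr 1
    refine intervalIntegral.integral_congr_ae (ae_of_all _ fun t ht => ?_)
    rw [uIoc_of_le hx.le] at ht
    rw [hr t ht.1]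

/-! ### The function `E₀` -/

theorem tendsto_pointGreen_of_pos (α : ℝ) {z : ℂ} (hz : 0 < z.im) (x : ℝ) :
    Tendsto (pointGreen α z x) (𝓝[<] (0 : ℝ))
      (𝓝 (if x < 0 then Complex.I * Complex.exp (-Complex.I * z * x) else 0)) := by
  have hz' : (conj z).im < 0 := by simpa using hz
  have hg (y : ℝ) (hy : y < 0) : pointGreen α z x y = freeGreen z (x - y) := by
    rw [pointGreen, freeGreen_of_neg hz', if_neg hy.not_gt]
    simp
  split_ifs with hx
  · have hc : Tendsto (fun y : ℝ => Complex.I * Complex.exp (-Complex.I * z * (x - y : ℝ)))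
        (𝓝[<] 0) (𝓝 (Complex.I * Complex.exp (-Complex.I * z * (x - (0 : ℝ) : ℝ)))) :=
      (Continuous.tendsto (by fun_prop) 0).mono_left nhdsWithin_le_nhds
    rw [sub_zero] at hc
    refine hc.congr' ?_
    filter_upwards [self_mem_nhdsWithin, mem_nhdsWithin_of_mem_nhds (Ioi_mem_nhds hx)] with y h1 h2
    rw [hg y h1, freeGreen_of_pos hz, if_pos (sub_neg.2 h2)]
  · refine tendsto_const_nhds.congr' ?_
    filter_upwards [self_mem_nhdsWithin] with y h1
    have : y < 0 := h1
    rw [hg y h1, freeGreen_of_pos hz, if_neg (by linarith)]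

/-- At `x = 0` the `β` term drops out because `θ(0) = 0`, so the factor `e^{iα}` appears only for `x
> 0`. -/
theorem tendsto_pointGreen_of_neg (α : ℝ) {z : ℂ} (hz : z.im < 0) (x : ℝ) :
    Tendsto (pointGreen α z x) (𝓝[<] (0 : ℝ))
      (𝓝 (if x < 0 then 0 else -Complex.I * Complex.exp (-Complex.I * z * x) *
        (if x = 0 then 1 else Complex.exp (Complex.I * α)))) := by
  have hz' : 0 < (conj z).im := by simpa using hz
  have hb : beta z α = Complex.I * (Complex.exp (Complex.I * α) - 1) := by
    simp [beta, heaviside, hz, hz.le]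
  split_ifs with hx hx0
  · refine tendsto_const_nhds.congr' ?_
    filter_upwards [mem_nhdsWithin_of_mem_nhds (Ioi_mem_nhds hx)] with y h1
    have : x < y := h1
    rw [pointGreen, freeGreen_of_neg hz, freeGreen_of_neg hz, if_neg (by linarith),
      if_neg hx.not_gt]
    simp
  · subst hx0
    have hc : Tendsto (fun y : ℝ => -Complex.I * Complex.exp (-Complex.I * z * (0 - y : ℝ)))
        (𝓝[<] 0) (𝓝 (-Complex.I * Complex.exp (-Complex.I * z * (0 - (0 : ℝ) : ℝ)))) :=
      (Continuous.tendsto (by fun_prop) 0).mono_left nhdsWithin_le_nhds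
    rw [sub_zero] at hc
    rw [mul_one]
    refine hc.congr' ?_
    filter_upwards [self_mem_nhdsWithin] with y h1
    have : y < 0 := h1
    rw [pointGreen, freeGreen_of_neg hz, freeGreen_of_neg hz, if_pos (by linarith),
      if_neg (lt_irrefl _)]
    simp
  · have hx1 : 0 < x := lt_of_le_of_ne (not_lt.1 hx) (Ne.symm hx0)
    have hc : Tendsto (fun y : ℝ => -Complex.I * Complex.exp (-Complex.I * z * (x - y : ℝ)) +
        -Complex.I * Complex.exp (-Complex.I * z * x) *
        (Complex.I * (Complex.exp (Complex.I * α) - 1)) *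
        conj (Complex.I * Complex.exp (-Complex.I * conj z * y)))
        (𝓝[<] 0) (𝓝 (-Complex.I * Complex.exp (-Complex.I * z * (x - (0 : ℝ) : ℝ)) +
        -Complex.I * Complex.exp (-Complex.I * z * x) *
        (Complex.I * (Complex.exp (Complex.I * α) - 1)) *
        conj (Complex.I * Complex.exp (-Complex.I * conj z * (0 : ℝ))))) :=
      (Continuous.tendsto (by fun_prop) 0).mono_left nhdsWithin_le_nhds
    have e : -Complex.I * Complex.exp (-Complex.I * z * (x - (0 : ℝ) : ℝ)) +
        -Complex.I * Complex.exp (-Complex.I * z * x) *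
        (Complex.I * (Complex.exp (Complex.I * α) - 1)) *
        conj (Complex.I * Complex.exp (-Complex.I * conj z * (0 : ℝ))) =
        -Complex.I * Complex.exp (-Complex.I * z * x) * Complex.exp (Complex.I * α) := by
      simp only [Complex.ofReal_zero, mul_zero, Complex.exp_zero, map_mul, map_one,
        Complex.conj_I, sub_zero]
      linear_combination Complex.exp (-Complex.I * z * x) * (Complex.exp (Complex.I * α) - 1) *
        Complex.I * Complex.I_sq
    rw [e] at hc
    refine hc.congr' ?_
    filter_upwards [self_mem_nhdsWithin] with y h1
    have h2 : y < 0 := h1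
    rw [pointGreen, freeGreen_of_neg hz, freeGreen_of_neg hz, freeGreen_of_pos hz',
      if_pos (by linarith), if_pos hx1, if_pos h2, hb]

theorem E0_of_pos (α : ℝ) {z : ℂ} (hz : 0 < z.im) (x : ℝ) :
    E0 α z x = if x < 0 then Complex.I * Complex.exp (-Complex.I * z * x) else 0 :=
  (tendsto_pointGreen_of_pos α hz x).limUnder_eq

theorem E0_of_neg (α : ℝ) {z : ℂ} (hz : z.im < 0) (x : ℝ) :
    E0 α z x = if x < 0 then 0 else -Complex.I * Complex.exp (-Complex.I * z * x) *
        (if x = 0 then 1 else Complex.exp (Complex.I * α)) :=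
  (tendsto_pointGreen_of_neg α hz x).limUnder_eq

theorem tendsto_E0 (α : ℝ) {z : ℂ} (hz : z.im ≠ 0) (x : ℝ) :
    Tendsto (pointGreen α z x) (𝓝[<] (0 : ℝ)) (𝓝 (E0 α z x)) := by
  rcases hz.lt_or_gt with hz | hz
  · rw [E0_of_neg α hz]
    exact tendsto_pointGreen_of_neg α hz x
  · rw [E0_of_pos α hz]
    exact tendsto_pointGreen_of_pos α hz x

theorem measurable_E0 (α : ℝ) {z : ℂ} (hz : z.im ≠ 0) : Measurable (E0 α z) := by
  rcases hz.lt_or_gt with hz | hz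
  · rw [funext (E0_of_neg α hz)]
    exact Measurable.ite measurableSet_Iio measurable_const
      (Measurable.mul (by fun_prop)
        (Measurable.ite (measurableSet_singleton 0) measurable_const measurable_const))
  · rw [funext (E0_of_pos α hz)]
    exact Measurable.ite measurableSet_Iio (by fun_prop) measurable_const

theorem memLp_E0 (α : ℝ) {z : ℂ} (hz : z.im ≠ 0) : MemLp (E0 α z) 2 volume := by
  refine (memLp_exp_neg_mul_abs (abs_pos.2 hz)).of_le (measurable_E0 α hz).aestronglyMeasurable
    (ae_of_all _ fun x => ?_)
  rw [Real.norm_of_nonneg (Real.exp_pos _).le]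
  rcases hz.lt_or_gt with hz | hz
  · rw [E0_of_neg α hz]
    split_ifs with h h0
    · simpa using (Real.exp_pos _).le
    · simp [h0]
    · rw [norm_mul, norm_mul, norm_exp_neg_I_mul, abs_of_neg hz, abs_of_nonneg (not_lt.1 h),
        norm_exp_I_mul_ofReal]
      simp
  · rw [E0_of_pos α hz]
    split_ifs with h
    · rw [norm_mul, norm_exp_neg_I_mul, abs_of_pos hz, abs_of_neg h]
      simp
    · simpa using (Real.exp_pos _).le

/-- In both half-planes these boundary values satisfy `E₀(-0) - e^{-iα} E₀(+0) = i`, which is what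
lets multiples of `E₀` correct the boundary condition. -/
theorem sobolevData_E0 (α : ℝ) {z : ℂ} (hz : z.im ≠ 0) :
    SobolevData (E0 α z) (fun x => -Complex.I * z * E0 α z x)
      (Complex.I * heaviside z.im)
      (-Complex.I * Complex.exp (Complex.I * α) * heaviside (-z.im)) := by
  have key (C D : ℂ) (hl : ∀ x < 0, E0 α z x = odeSolution z 0 C x)
      (hr : ∀ x, 0 < x → E0 α z x = odeSolution z 0 D x) :=
    SobolevData.of_odeSolution (memLp_E0 α hz) MemLp.zero hl hr
  simp only [Pi.zero_apply, mul_zero, sub_zero, odeSolution,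
    intervalIntegral.integral_zero] at key
  rcases hz.lt_or_gt with hz | hz
  · have := key 0 (-Complex.exp (Complex.I * α)) (fun x hx => ?_) (fun x hx => ?_)
    · simpa [heaviside, hz, hz.le, hz.not_gt] using this
    · rw [E0_of_neg α hz, if_pos hx, mul_zero]
    · rw [E0_of_neg α hz, if_neg hx.not_gt, if_neg hx.ne']
      ring
  · have := key 1 0 (fun x hx => ?_) (fun x hx => ?_)
    · simpa [heaviside, hz, hz.le, hz.not_gt] using this
    · rw [E0_of_pos α hz, if_pos hx, mul_one]
    · rw [E0_of_pos α hz, if_neg hx.not_gt, mul_zero]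

/-! ### Potentials of the Green function -/

/-- With the exponentials separated, `β` only multiplies the kernel by `e^{-iα}` when `x < 0 < y`.
-/
theorem pointGreen_of_pos (α : ℝ) {z : ℂ} (hz : 0 < z.im) (x y : ℝ) :
    pointGreen α z x y = Complex.I * Complex.exp (-Complex.I * z * x) *
      ((Ioi x).indicator (fun y : ℝ => Complex.exp (Complex.I * z * y)) y -
        (if x < 0 then 1 - Complex.exp (-Complex.I * α) else 0) *
          (Ioi 0).indicator (fun y : ℝ => Complex.exp (Complex.I * z * y)) y) := by
  have hz' : (conj z).im < 0 := by simpa using hz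
  have hb : beta z α = Complex.I * (1 - Complex.exp (-Complex.I * α)) := by
    simp [beta, heaviside, hz, hz.le]
  have he : Complex.exp (-Complex.I * z * (x - y : ℝ)) =
      Complex.exp (-Complex.I * z * x) * Complex.exp (Complex.I * z * y) := by
    rw [← Complex.exp_add]
    congr 1
    push_cast
    ring
  have hcj : conj (-Complex.I * Complex.exp (-Complex.I * conj z * y)) =
      Complex.I * Complex.exp (Complex.I * z * y) := by
    rw [map_mul, ← Complex.exp_conj]
    simp
  rw [pointGreen, freeGreen_of_pos hz, freeGreen_of_pos hz, freeGreen_of_neg hz', hb, he,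
    apply_ite conj, hcj, map_zero]
  simp only [indicator_apply, mem_Ioi, sub_neg]
  have h3 := Complex.I_sq
  split_ifs
  all_goals first | ring1 | skip
  all_goals linear_combination (Complex.I * Complex.exp (-Complex.I * z * x) *
    (1 - Complex.exp (-Complex.I * α)) * Complex.exp (Complex.I * z * y)) * h3

theorem pointGreen_of_neg (α : ℝ) {z : ℂ} (hz : z.im < 0) (x y : ℝ) :
    pointGreen α z x y = -Complex.I * Complex.exp (-Complex.I * z * x) *
      ((Iio x).indicator (fun y : ℝ => Complex.exp (Complex.I * z * y)) y +
        (if 0 < x then Complex.exp (Complex.I * α) - 1 else 0) *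
          (Iio 0).indicator (fun y : ℝ => Complex.exp (Complex.I * z * y)) y) := by
  have hz' : 0 < (conj z).im := by simpa using hz
  have hb : beta z α = Complex.I * (Complex.exp (Complex.I * α) - 1) := by
    simp [beta, heaviside, hz, hz.le]
  have he : Complex.exp (-Complex.I * z * (x - y : ℝ)) =
      Complex.exp (-Complex.I * z * x) * Complex.exp (Complex.I * z * y) := by
    rw [← Complex.exp_add]
    congr 1
    push_cast
    ring
  have hcj : conj (Complex.I * Complex.exp (-Complex.I * conj z * y)) =
      -Complex.I * Complex.exp (Complex.I * z * y) := by
    rw [map_mul, ← Complex.exp_conj]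
    simp
  rw [pointGreen, freeGreen_of_neg hz, freeGreen_of_neg hz, freeGreen_of_pos hz', hb, he,
    apply_ite conj, hcj, map_zero]
  simp only [indicator_apply, mem_Iio, sub_pos]
  have h3 := Complex.I_sq
  split_ifs
  all_goals first | ring1 | skip
  all_goals linear_combination (Complex.I * Complex.exp (-Complex.I * z * x) *
    (Complex.exp (Complex.I * α) - 1) * Complex.exp (Complex.I * z * y)) * h3

theorem norm_exp_I_mul (z : ℂ) (x : ℝ) :
    ‖Complex.exp (Complex.I * z * x)‖ = Real.exp (-z.im * x) := by
  rw [Complex.norm_exp]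
  simp

theorem integrableOn_Ioi_exp_mul {z : ℂ} (hz : 0 < z.im) (h : L2R) (a : ℝ) :
    IntegrableOn (fun y : ℝ => Complex.exp (Complex.I * z * y) * h y) (Ioi a) := by
  have : MemLp (fun y : ℝ => Complex.exp (Complex.I * z * y)) 2 (volume.restrict (Ioi a)) := by
    rw [memLp_two_iff_integrable_sq_norm (by fun_prop)]
    refine (exp_neg_integrableOn_Ioi a (mul_pos two_pos hz)).congr (ae_of_all _ fun x => ?_)
    simp only [norm_exp_I_mul, ← Real.exp_nat_mul]
    congr 1
    push_cast
    ring
  exact this.integrable_mul ((Lp.memLp h).restrict _)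

theorem integrableOn_Iio_exp_mul {z : ℂ} (hz : z.im < 0) (h : L2R) (a : ℝ) :
    IntegrableOn (fun y : ℝ => Complex.exp (Complex.I * z * y) * h y) (Iio a) := by
  have : MemLp (fun y : ℝ => Complex.exp (Complex.I * z * y)) 2 (volume.restrict (Iio a)) := by
    rw [memLp_two_iff_integrable_sq_norm (by fun_prop)]
    refine ((integrableOn_exp_mul_Iic (mul_pos two_pos (neg_pos.2 hz)) a).mono_set
      Iio_subset_Iic_self).congr (ae_of_all _ fun x => ?_)
    simp only [norm_exp_I_mul, ← Real.exp_nat_mul]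
    congr 1
    push_cast
    ring
  exact this.integrable_mul ((Lp.memLp h).restrict _)

/-- Splitting `∫_x^∞ = ∫_0^∞ - ∫_0^x` exhibits the potential as an explicit solution; only the
constant differs between the two sides of the origin. -/
theorem greenPotential_of_pos (α : ℝ) {z : ℂ} (hz : 0 < z.im) (h : L2R) (x : ℝ) :
    greenPotential α h z x = odeSolution z h
      ((if x < 0 then Complex.exp (-Complex.I * α) else 1) *
        ∫ y in Ioi (0 : ℝ), Complex.exp (Complex.I * z * y) * h y) x := by
  have hi := integrableOn_Ioi_exp_mul hz h
  have e (y : ℝ) : pointGreen α z x y * h y = Complex.I * Complex.exp (-Complex.I * z * x) *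
      ((Ioi x).indicator (fun y : ℝ => Complex.exp (Complex.I * z * y) * h y) y -
        (if x < 0 then 1 - Complex.exp (-Complex.I * α) else 0) *
          (Ioi 0).indicator (fun y : ℝ => Complex.exp (Complex.I * z * y) * h y) y) := by
    rw [pointGreen_of_pos α hz, indicator_mul_left, indicator_mul_left]
    ring
  rw [greenPotential]
  simp_rw [e]
  rw [integral_const_mul, integral_sub (((integrable_indicator_iff measurableSet_Ioi).2 (hi x)))
    (((integrable_indicator_iff measurableSet_Ioi).2 (hi 0)).const_mul _), integral_const_mul,
    integral_indicator measurableSet_Ioi, integral_indicator measurableSet_Ioi, odeSolution,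
    ← intervalIntegral.integral_Ioi_sub_Ioi' (hi 0) (hi x)]
  split_ifs <;> ring

theorem greenPotential_of_neg (α : ℝ) {z : ℂ} (hz : z.im < 0) (h : L2R) (x : ℝ) :
    greenPotential α h z x = odeSolution z h
      (-(if 0 < x then Complex.exp (Complex.I * α) else 1) *
        ∫ y in Iio (0 : ℝ), Complex.exp (Complex.I * z * y) * h y) x := by
  have hi := integrableOn_Iio_exp_mul hz h
  have e (y : ℝ) : pointGreen α z x y * h y = -Complex.I * Complex.exp (-Complex.I * z * x) *
      ((Iio x).indicator (fun y : ℝ => Complex.exp (Complex.I * z * y) * h y) y +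
        (if 0 < x then Complex.exp (Complex.I * α) - 1 else 0) *
          (Iio 0).indicator (fun y : ℝ => Complex.exp (Complex.I * z * y) * h y) y) := by
    rw [pointGreen_of_neg α hz, indicator_mul_left, indicator_mul_left]
    ring
  rw [greenPotential]
  simp_rw [e]
  rw [integral_const_mul, integral_add (((integrable_indicator_iff measurableSet_Iio).2 (hi x)))
    (((integrable_indicator_iff measurableSet_Iio).2 (hi 0)).const_mul _), integral_const_mul,
    integral_indicator measurableSet_Iio, integral_indicator measurableSet_Iio, odeSolution,
    ← intervalIntegral.integral_Iio_sub_Iio' (hi x) (hi 0)]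
  split_ifs <;> ring

/-- The right side is the value at `-0` of the potential of `h`, so that value is a pairing with
`E₀(·, conj z)`. -/
theorem pairing_E0_of_pos (α : ℝ) {z : ℂ} (hz : 0 < z.im) (h : L2R) :
    pairing h (E0 α (conj z)) = Complex.I * (Complex.exp (-Complex.I * α) *
      ∫ y in Ioi (0 : ℝ), Complex.exp (Complex.I * z * y) * h y) := by
  have hz' : (conj z).im < 0 := by simpa using hz
  rw [pairing, ← integral_const_mul, ← integral_const_mul, ← integral_indicator measurableSet_Ioi]
  refine integral_congr_ae ?_
  filter_upwards [ae_ne_zero] with y hy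
  rw [E0_of_neg α hz', if_neg hy]
  simp only [indicator_apply, mem_Ioi]
  rcases hy.lt_or_gt with h0 | h0
  · simp [h0, h0.le]
  · rw [if_neg h0.not_gt, if_pos h0, map_mul, map_mul, ← Complex.exp_conj, ← Complex.exp_conj]
    simp only [map_mul, map_neg, Complex.conj_I, Complex.conj_conj, Complex.conj_ofReal, neg_neg]
    ring

theorem pairing_E0_of_neg (α : ℝ) {z : ℂ} (hz : z.im < 0) (h : L2R) :
    pairing h (E0 α (conj z)) = Complex.I *
      -∫ y in Iio (0 : ℝ), Complex.exp (Complex.I * z * y) * h y := by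
  have hz' : 0 < (conj z).im := by simpa using hz
  rw [pairing, mul_neg, ← neg_mul, ← integral_const_mul, ← integral_indicator measurableSet_Iio]
  refine integral_congr_ae (ae_of_all _ fun y => ?_)
  simp only [E0_of_pos α hz', indicator_apply, mem_Iio]
  split_ifs
  · rw [map_mul, ← Complex.exp_conj]
    simp only [map_mul, map_neg, Complex.conj_I, Complex.conj_conj, Complex.conj_ofReal, neg_neg]
    ring
  · simp

/-- The potential solves the problem with `v₁ = v₂ = 0`: its boundary values differ by the factor
`e^{iα}`. -/
theorem sobolevData_greenPotential (α : ℝ) {z : ℂ} (hz : z.im ≠ 0) (h : L2R) :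
    SobolevData (greenPotential α h z)
      (fun x => -Complex.I * z * greenPotential α h z x - Complex.I * h x)
      (pairing h (E0 α (conj z)))
      (Complex.exp (Complex.I * α) * pairing h (E0 α (conj z))) := by
  have hu := memLp_greenPotential α hz h
  rcases hz.lt_or_gt with hz | hz
  · rw [pairing_E0_of_neg α hz, mul_left_comm]
    refine SobolevData.of_odeSolution hu (Lp.memLp h) (fun x hx => ?_) (fun x hx => ?_)
    · rw [greenPotential_of_neg α hz, if_neg hx.not_gt, neg_one_mul]
    · rw [greenPotential_of_neg α hz, if_pos hx, neg_mul, mul_neg]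
  · have he : Complex.exp (Complex.I * α) * Complex.exp (-Complex.I * α) = 1 := by
      rw [← Complex.exp_add]
      simp
    rw [pairing_E0_of_pos α hz, mul_left_comm (Complex.exp _), ← mul_assoc (Complex.exp _), he]
    refine SobolevData.of_odeSolution hu (Lp.memLp h) (fun x hx => ?_) (fun x hx => ?_)
    · rw [greenPotential_of_pos α hz, if_pos hx]
    · rw [greenPotential_of_pos α hz, if_neg hx.not_gt]

/-! ### Solutions in `L₂` with prescribed boundary values -/

theorem conj_pairing (f g : ℝ → ℂ) : conj (pairing f g) = pairing g f := by
  rw [pairing, pairing, ← integral_conj]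
  congr 1
  funext x
  rw [map_mul, Complex.conj_conj, mul_comm]

theorem pairing_congr {f f' g g' : ℝ → ℂ} (hf : f =ᵐ[volume] f') (hg : g =ᵐ[volume] g') :
    pairing f g = pairing f' g' := by
  refine integral_congr_ae ?_
  filter_upwards [hf, hg] with x h1 h2
  rw [h1, h2]

/-- `u ∈ W₂¹(Ω)` solves `i u' - z u = h` on `Ω`, with boundary values `l = u(-0)` and
`r = u(+0)`. -/
structure IsSolution (z : ℂ) (u h : L2R) (l r : ℂ) : Prop where
  hasWeakDeriv : HasWeakDeriv u (-(Complex.I * z) • u - Complex.I • h : L2R)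
  leftValue_eq : leftValue u = l
  rightValue_eq : rightValue u = r

namespace IsSolution

variable {z : ℂ} {u u₁ u₂ h h₁ h₂ : L2R} {l r l₁ l₂ r₁ r₂ : ℂ}

theorem mem_sobolev (hu : IsSolution z u h l r) : u ∈ sobolev := ⟨_, hu.hasWeakDeriv⟩

theorem congr {u' h' : L2R} {l' r' : ℂ} (hu : IsSolution z u h l r) (eu : u' = u) (eh : h' = h)
    (el : l' = l) (er : r' = r) : IsSolution z u' h' l' r' := by
  rwa [eu, eh, el, er]

theorem weakDeriv_eq (hu : IsSolution z u h l r) :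
    weakDeriv ⟨u, hu.mem_sobolev⟩ = -(Complex.I * z) • u - Complex.I • h :=
  (hasWeakDeriv_weakDeriv _).unique hu.hasWeakDeriv

theorem add (hu₁ : IsSolution z u₁ h₁ l₁ r₁) (hu₂ : IsSolution z u₂ h₂ l₂ r₂) :
    IsSolution z (u₁ + u₂) (h₁ + h₂) (l₁ + l₂) (r₁ + r₂) := by
  refine ⟨?_, ?_, ?_⟩
  · have e : -(Complex.I * z) • (u₁ + u₂) - Complex.I • (h₁ + h₂) =
        (-(Complex.I * z) • u₁ - Complex.I • h₁) + (-(Complex.I * z) • u₂ - Complex.I • h₂) := by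
      module
    rw [e]
    exact hu₁.hasWeakDeriv.add hu₂.hasWeakDeriv
  · rw [leftValue_add hu₁.mem_sobolev hu₂.mem_sobolev, hu₁.leftValue_eq, hu₂.leftValue_eq]
  · rw [rightValue_add hu₁.mem_sobolev hu₂.mem_sobolev, hu₁.rightValue_eq, hu₂.rightValue_eq]

theorem smul (c : ℂ) (hu : IsSolution z u h l r) :
    IsSolution z (c • u) (c • h) (c * l) (c * r) := by
  refine ⟨?_, ?_, ?_⟩
  · have e : -(Complex.I * z) • (c • u) - Complex.I • (c • h) =
        c • (-(Complex.I * z) • u - Complex.I • h) := by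
      module
    rw [e]
    exact hu.hasWeakDeriv.smul c
  · rw [leftValue_smul c hu.mem_sobolev, hu.leftValue_eq]
  · rw [rightValue_smul c hu.mem_sobolev, hu.rightValue_eq]

theorem of_sobolevData {f : ℝ → ℂ}
    (hf : SobolevData f (fun x => -Complex.I * z * f x - Complex.I * h x) l r) :
    IsSolution z (hf.memLp.toLp f) h l r := by
  refine ⟨hf.hasWeakDeriv.congr hf.memLp.coeFn_toLp.symm ?_, hf.leftValue_eq, hf.rightValue_eq⟩
  filter_upwards [Lp.coeFn_sub (-(Complex.I * z) • hf.memLp.toLp f) (Complex.I • h),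
    Lp.coeFn_smul (-(Complex.I * z)) (hf.memLp.toLp f), Lp.coeFn_smul Complex.I h,
    hf.memLp.coeFn_toLp] with x e1 e2 e3 e4
  rw [e1, Pi.sub_apply, e2, e3, Pi.smul_apply, Pi.smul_apply, e4, smul_eq_mul, smul_eq_mul]
  ring

/-- Once the boundary terms cancel, integration by parts cancels the terms with `z` as well, because
the second solution belongs to `conj z`. -/
theorem pairing_right_eq (hu₁ : IsSolution z u₁ h₁ l₁ r₁)
    (hu₂ : IsSolution (conj z) u₂ h₂ l₂ r₂) (hb : l₁ * conj l₂ = r₁ * conj r₂) :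
    pairing u₁ h₂ = pairing h₁ u₂ := by
  have key := integral_by_parts ⟨u₁, hu₁.mem_sobolev⟩ ⟨u₂, hu₂.mem_sobolev⟩
  rw [hu₁.weakDeriv_eq, hu₂.weakDeriv_eq] at key
  dsimp only at key
  rw [hu₁.leftValue_eq, hu₁.rightValue_eq, hu₂.leftValue_eq, hu₂.rightValue_eq, hb, sub_self] at key
  simp only [pairing_eq_inner, inner_sub_left, inner_sub_right, inner_smul_left,
    inner_smul_right, map_neg, map_mul, Complex.conj_I, Complex.conj_conj] at key ⊢
  have h2 : Complex.I * (inner ℂ h₂ u₁ - inner ℂ u₂ h₁) = 0 := by linear_combination key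
  exact sub_eq_zero.1 ((mul_eq_zero.1 h2).resolve_left Complex.I_ne_zero)

/-- `ha` and `hb` make the nonlocal terms of the operator cancel `a v₁ + b v₂`. Eliminating the
pairings from the boundary condition by means of them leaves exactly `hlr`. -/
theorem exists_nonlocalOp_eq {v₁ v₂ : L2R} {α : ℝ} {a b : ℂ}
    (hu : IsSolution z u (h - a • v₁ - b • v₂) l r)
    (ha : l + Complex.I / 2 * pairing u v₁ = a) (hb : r - Complex.I / 2 * pairing u v₂ = b)
    (hlr : l - Complex.exp (-Complex.I * α) * r = 2 * a - 2 * Complex.exp (-Complex.I * α) * b) :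
    ∃ hd : u ∈ (nonlocalOp v₁ v₂ α).domain, nonlocalOp v₁ v₂ α ⟨u, hd⟩ - z • u = h := by
  have he : Complex.exp (Complex.I * α) * Complex.exp (-Complex.I * α) = 1 := by
    rw [← Complex.exp_add]
    simp
  refine ⟨mem_nonlocalOp_domain.2 ⟨hu.mem_sobolev, ?_⟩, ?_⟩
  · rw [hu.leftValue_eq, hu.rightValue_eq]
    linear_combination 2 * hb - 2 * Complex.exp (Complex.I * α) * ha
      + Complex.exp (Complex.I * α) * hlr + (r - 2 * b) * he
  · rw [nonlocalOp_apply]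
    dsimp only
    rw [hu.weakDeriv_eq, hu.leftValue_eq, hu.rightValue_eq, ha, hb]
    match_scalars <;> ring_nf <;> simp

end IsSolution

/-! ### Reduction of the resolvent equation to a linear system for two numbers -/

section Elements

variable (v₁ v₂ h : L2R) (α : ℝ) {z : ℂ} (hz : z.im ≠ 0)

/-- The element `∫ 𝒢_z(·, y; α) h(y) dy` of `L₂`. -/
noncomputable def greenLp : L2R := (memLp_greenPotential α hz h).toLp _

/-- The element `E₀(·, z)` of `L₂`. -/
noncomputable def E0Lp : L2R := (memLp_E0 α hz).toLp _

/-- The element `ℰ₁(·, z)` of `L₂`. -/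
noncomputable def calELp₁ : L2R := greenLp v₁ α hz + (2 * Complex.I) • E0Lp α hz

/-- The element `ℰ₂(·, z)` of `L₂`. -/
noncomputable def calELp₂ : L2R :=
  greenLp v₂ α hz + (-2 * Complex.I * Complex.exp (-Complex.I * α)) • E0Lp α hz

theorem greenLp_coeFn : greenLp h α hz =ᵐ[volume] greenPotential α h z :=
  (memLp_greenPotential α hz h).coeFn_toLp

theorem E0Lp_coeFn : E0Lp α hz =ᵐ[volume] E0 α z := (memLp_E0 α hz).coeFn_toLp

theorem calELp₁_coeFn : calELp₁ v₁ α hz =ᵐ[volume] calE v₁ v₂ α z 0 := by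
  filter_upwards [Lp.coeFn_add (greenLp v₁ α hz) ((2 * Complex.I) • E0Lp α hz),
    Lp.coeFn_smul (2 * Complex.I) (E0Lp α hz), greenLp_coeFn v₁ α hz,
    E0Lp_coeFn α hz] with x e1 e2 e3 e4
  rw [calELp₁, e1, Pi.add_apply, e2, Pi.smul_apply, e3, e4]
  rfl

theorem calELp₂_coeFn : calELp₂ v₂ α hz =ᵐ[volume] calE v₁ v₂ α z 1 := by
  filter_upwards [Lp.coeFn_add (greenLp v₂ α hz)
      ((-2 * Complex.I * Complex.exp (-Complex.I * α)) • E0Lp α hz),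
    Lp.coeFn_smul (-2 * Complex.I * Complex.exp (-Complex.I * α)) (E0Lp α hz),
    greenLp_coeFn v₂ α hz, E0Lp_coeFn α hz] with x e1 e2 e3 e4
  rw [calELp₂, e1, Pi.add_apply, e2, Pi.smul_apply, e3, e4, smul_eq_mul]
  simp only [calE, Matrix.cons_val_one, Matrix.cons_val_fin_one]
  ring

theorem memLp_calE (hz : z.im ≠ 0) (j : Fin 2) : MemLp (calE v₁ v₂ α z j) 2 volume := by
  fin_cases j
  · exact (memLp_congr_ae (calELp₁_coeFn v₁ v₂ α hz)).1 (Lp.memLp _)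
  · exact (memLp_congr_ae (calELp₂_coeFn v₁ v₂ α hz)).1 (Lp.memLp _)

theorem isSolution_greenLp : IsSolution z (greenLp h α hz) h (pairing h (E0 α (conj z)))
    (Complex.exp (Complex.I * α) * pairing h (E0 α (conj z))) :=
  IsSolution.of_sobolevData (sobolevData_greenPotential α hz h)

theorem isSolution_E0Lp : IsSolution z (E0Lp α hz) 0 (Complex.I * heaviside z.im)
    (-Complex.I * Complex.exp (Complex.I * α) * heaviside (-z.im)) := by
  have hd := sobolevData_E0 α hz
  refine ⟨hd.hasWeakDeriv.congr hd.memLp.coeFn_toLp.symm ?_, hd.leftValue_eq, hd.rightValue_eq⟩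
  rw [smul_zero, sub_zero]
  filter_upwards [Lp.coeFn_smul (-(Complex.I * z)) (E0Lp α hz), E0Lp_coeFn α hz] with x e1 e2
  rw [e1, Pi.smul_apply, e2, smul_eq_mul, neg_mul Complex.I]

/-- The potential operators at `z` and `conj z` are adjoint: the factors `e^{iα}` in the boundary
values are unimodular, so the boundary terms cancel. -/
theorem pairing_greenLp (hz' : (conj z).im ≠ 0) (h' : L2R) :
    pairing (greenLp h α hz) h' = pairing h (greenLp h' α hz') := by
  refine (isSolution_greenLp h α hz).pairing_right_eq (isSolution_greenLp h' α hz') ?_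
  have he : Complex.exp (Complex.I * α) * conj (Complex.exp (Complex.I * α)) = 1 := by
    rw [← Complex.exp_conj, ← Complex.exp_add]
    simp
  rw [map_mul]
  linear_combination (-pairing h (E0 α (conj z)) *
    conj (pairing h' (E0 α (conj (conj z))))) * he

theorem pairing_greenPotential (hz : z.im ≠ 0) (h' : L2R) :
    pairing (greenPotential α h z) h' = pairing h (greenPotential α h' (conj z)) := by
  have hz' : (conj z).im ≠ 0 := by simpa using hz
  rw [pairing_congr (greenLp_coeFn h α hz).symm EventuallyEq.rfl,
    pairing_greenLp h α hz hz' h', pairing_congr EventuallyEq.rfl (greenLp_coeFn h' α hz')]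

/-- Conjugation together with `z ↦ conj z` exchanges the pairings with `E₀(·, z)` and `E₀(·, conj
z)`, reverses the sign of `Im z`, and moves the Green potential to the other argument of its
pairing. -/
theorem Gam_conjTranspose (hz : z.im ≠ 0) :
    (Gam v₁ v₂ α (conj z)).conjTranspose = Gam v₁ v₂ α z := by
  have hs : Real.sign (-z.im) = -Real.sign z.im := by
    rcases hz.lt_or_gt with h | h
    · rw [Real.sign_of_neg h, Real.sign_of_pos (neg_pos.2 h), neg_neg]
    · rw [Real.sign_of_pos h, Real.sign_of_neg (neg_neg_of_pos h)]
  have he : conj (Complex.exp (Complex.I * α)) = Complex.exp (-Complex.I * α) := by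
    rw [← Complex.exp_conj]
    simp
  have he' : conj (Complex.exp (-Complex.I * α)) = Complex.exp (Complex.I * α) := by
    rw [← he, Complex.conj_conj]
  have hp (v w : L2R) : pairing w (greenPotential α v (conj z)) =
      pairing (greenPotential α w z) v := (pairing_greenPotential w α hz v).symm
  ext j k
  fin_cases j <;> fin_cases k <;>
    simp only [Gam, Matrix.conjTranspose_apply, Matrix.of_apply, Matrix.cons_val',
      Matrix.cons_val_zero, Matrix.cons_val_one, Matrix.cons_val_fin_one, Fin.zero_eta, Fin.mk_one, Fin.isValue,
      RCLike.star_def, map_mul, map_add, map_sub, map_neg, map_div₀, Complex.conj_I,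
      Complex.conj_ofNat, Complex.conj_ofReal, conj_pairing, Complex.conj_conj, he, he',
      Complex.conj_im, hs, neg_neg, Complex.ofReal_neg, hp] <;>
    ring

theorem pairing_greenLp_eq (h' : L2R) :
    pairing (greenLp h α hz) h' = pairing (greenPotential α h z) h' :=
  pairing_congr (greenLp_coeFn h α hz) EventuallyEq.rfl

theorem pairing_E0Lp_eq (h' : L2R) : pairing (E0Lp α hz) h' = pairing (E0 α z) h' :=
  pairing_congr (E0Lp_coeFn α hz) EventuallyEq.rfl

theorem isSolution_calELp₁ : IsSolution z (calELp₁ v₁ α hz) v₁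
    (pairing v₁ (E0 α (conj z)) - 2 * heaviside z.im)
    (Complex.exp (Complex.I * α) * (pairing v₁ (E0 α (conj z)) + 2 * heaviside (-z.im))) := by
  refine ((isSolution_greenLp v₁ α hz).add ((isSolution_E0Lp α hz).smul
    (2 * Complex.I))).congr rfl ?_ ?_ ?_
  · rw [smul_zero, add_zero]
  · linear_combination (-2 * heaviside z.im : ℂ) * Complex.I_sq
  · linear_combination (2 * Complex.exp (Complex.I * α) * heaviside (-z.im) : ℂ) * Complex.I_sq

theorem isSolution_calELp₂ : IsSolution z (calELp₂ v₂ α hz) v₂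
    (pairing v₂ (E0 α (conj z)) + 2 * Complex.exp (-Complex.I * α) * heaviside z.im)
    (Complex.exp (Complex.I * α) * pairing v₂ (E0 α (conj z)) - 2 * heaviside (-z.im)) := by
  have he : Complex.exp (Complex.I * α) * Complex.exp (-Complex.I * α) = 1 := by
    rw [← Complex.exp_add]
    simp
  refine ((isSolution_greenLp v₂ α hz).add ((isSolution_E0Lp α hz).smul
    (-2 * Complex.I * Complex.exp (-Complex.I * α)))).congr rfl ?_ ?_ ?_
  · rw [smul_zero, add_zero]
  · linear_combination (2 * Complex.exp (-Complex.I * α) * heaviside z.im : ℂ) * Complex.I_sq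
  · linear_combination (-2 * Complex.exp (Complex.I * α) * Complex.exp (-Complex.I * α) *
      heaviside (-z.im) : ℂ) * Complex.I_sq + (2 * heaviside (-z.im) : ℂ) * he

theorem heaviside_add_heaviside_neg {t : ℝ} (ht : t ≠ 0) :
    (heaviside t : ℂ) + heaviside (-t) = 1 := by
  rcases ht.lt_or_gt with h | h <;> simp [heaviside, h, h.not_gt]

theorem sign_eq_heaviside_sub {t : ℝ} (ht : t ≠ 0) :
    ((Real.sign t : ℝ) : ℂ) = heaviside t - heaviside (-t) := by
  rcases ht.lt_or_gt with h | h
  · simp [heaviside, h, h.not_gt, Real.sign_of_neg h]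
  · simp [heaviside, h, h.not_gt, Real.sign_of_pos h]

/-- The ansatz meets the differential equation and the boundary relation for any `a`, `b`. The two
hypotheses are the requirements that `a` and `b` agree with the values computed from `u`, multiplied
by `2i` and `-2i`; this is where the entries of `Γ` come from. -/
theorem exists_nonlocalOp_eq_of_Gam {a b : ℂ} (hz' : (conj z).im ≠ 0)
    (h₁ : Gam v₁ v₂ α z 1 1 * a - Gam v₁ v₂ α z 0 1 * b = pairing h (calELp₁ v₁ α hz'))
    (h₂ : Gam v₁ v₂ α z 0 0 * b - Gam v₁ v₂ α z 1 0 * a = pairing h (calELp₂ v₂ α hz')) :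
    ∃ u : L2R, u = greenLp h α hz - a • calELp₁ v₁ α hz - b • calELp₂ v₂ α hz ∧
      leftValue u + Complex.I / 2 * pairing u v₁ = a ∧
      rightValue u - Complex.I / 2 * pairing u v₂ = b ∧
      ∃ hd : u ∈ (nonlocalOp v₁ v₂ α).domain, nonlocalOp v₁ v₂ α ⟨u, hd⟩ - z • u = h := by
  have he : Complex.exp (Complex.I * α) * Complex.exp (-Complex.I * α) = 1 := by
    rw [← Complex.exp_add]
    simp
  have hec : conj (Complex.exp (-Complex.I * α)) = Complex.exp (Complex.I * α) := by
    rw [← Complex.exp_conj]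
    simp
  have hθ := heaviside_add_heaviside_neg hz
  set u := greenLp h α hz - a • calELp₁ v₁ α hz - b • calELp₂ v₂ α hz with hu
  have hs := ((isSolution_greenLp h α hz).add ((isSolution_calELp₁ v₁ α hz).smul (-a))).add
    ((isSolution_calELp₂ v₂ α hz).smul (-b))
  have hs' := hs.congr (u' := u) (h' := h - a • v₁ - b • v₂) (by rw [hu]; module) (by module)
    rfl rfl
  have hE : pairing h (E0Lp α hz') = pairing h (E0 α (conj z)) :=
    pairing_congr EventuallyEq.rfl (E0Lp_coeFn α hz')
  -- The adjoint relation moves the potential off `h`, so that `h` enters only through pairings with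
  -- functions at `conj z`.
  have hpu (v : L2R) : pairing u v = pairing h (greenLp v α hz')
      - a * (pairing (greenPotential α v₁ z) v + 2 * Complex.I * pairing (E0 α z) v)
      - b * (pairing (greenPotential α v₂ z) v
        - 2 * Complex.I * Complex.exp (-Complex.I * α) * pairing (E0 α z) v) := by
    rw [← pairing_greenLp h α hz, ← pairing_greenLp_eq v₁ α hz, ← pairing_greenLp_eq v₂ α hz,
      ← pairing_E0Lp_eq α hz, hu, calELp₁, calELp₂]
    simp only [pairing_eq_inner, inner_sub_right, inner_add_right, inner_smul_right]
    ring
  have hc₁ : pairing h (calELp₁ v₁ α hz') = pairing h (greenLp v₁ α hz') -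
      2 * Complex.I * pairing h (E0 α (conj z)) := by
    rw [← hE, calELp₁]
    simp only [pairing_eq_inner, inner_add_left, inner_smul_left, map_mul, Complex.conj_I,
      Complex.conj_ofNat]
    ring
  have hc₂ : pairing h (calELp₂ v₂ α hz') = pairing h (greenLp v₂ α hz') +
      2 * Complex.I * Complex.exp (Complex.I * α) * pairing h (E0 α (conj z)) := by
    rw [← hE, calELp₂]
    simp only [pairing_eq_inner, inner_add_left, inner_smul_left, map_mul, map_neg, Complex.conj_I,
      Complex.conj_ofNat, hec]
    ring
  rw [hc₁] at h₁
  rw [hc₂] at h₂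
  simp only [Gam, Matrix.of_apply, Matrix.cons_val', Matrix.cons_val_zero, Matrix.cons_val_one,
    Matrix.cons_val_fin_one, sign_eq_heaviside_sub hz] at h₁ h₂
  have ha : leftValue u + Complex.I / 2 * pairing u v₁ = a := by
    rw [hs'.leftValue_eq, hpu]
    linear_combination (-Complex.I / 2) * h₁ + a * hθ + (pairing h (E0 α (conj z))
      - (-(heaviside z.im - heaviside (-z.im)) + pairing v₁ (E0 α (conj z))
        - pairing (E0 α z) v₁ + Complex.I / 2 * pairing (greenPotential α v₁ z) v₁) * a
      - (2 * Complex.exp (-Complex.I * α) * heaviside z.im + pairing v₂ (E0 α (conj z))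
        + Complex.exp (-Complex.I * α) * pairing (E0 α z) v₁
        + Complex.I / 2 * pairing (greenPotential α v₂ z) v₁) * b
      - a * pairing (E0 α z) v₁
      + b * Complex.exp (-Complex.I * α) * pairing (E0 α z) v₁) * Complex.I_sq
  have hb : rightValue u - Complex.I / 2 * pairing u v₂ = b := by
    rw [hs'.rightValue_eq, hpu]
    linear_combination (Complex.I / 2) * h₂ + b * hθ
      + (Complex.exp (Complex.I * α) * pairing h (E0 α (conj z))
      - (heaviside z.im - heaviside (-z.im)
        + Complex.exp (Complex.I * α) * pairing v₂ (E0 α (conj z))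
        - Complex.exp (-Complex.I * α) * pairing (E0 α z) v₂
        - Complex.I / 2 * pairing (greenPotential α v₂ z) v₂) * b
      - (2 * Complex.exp (Complex.I * α) * heaviside (-z.im)
        + Complex.exp (Complex.I * α) * pairing v₁ (E0 α (conj z)) + pairing (E0 α z) v₂
        - Complex.I / 2 * pairing (greenPotential α v₁ z) v₂) * a
      + a * pairing (E0 α z) v₂
      - b * Complex.exp (-Complex.I * α) * pairing (E0 α z) v₂) * Complex.I_sq
  refine ⟨u, rfl, ha, hb, hs'.exists_nonlocalOp_eq ?_ ?_ ?_⟩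
  · rw [← hs'.leftValue_eq, ha]
  · rw [← hs'.rightValue_eq, hb]
  · linear_combination (-pairing h (E0 α (conj z)) + a * pairing v₁ (E0 α (conj z))
      + b * pairing v₂ (E0 α (conj z)) + 2 * a * heaviside (-z.im)) * he
      + (2 * a - 2 * Complex.exp (-Complex.I * α) * b) * hθ

end Elements

/-! ### Invertibility of `Γ(z)` and the resolvent kernel -/

section Resolvent

variable (v₁ v₂ h : L2R) (α : ℝ) {z : ℂ}

theorem det_Gam_ne_zero (hz : z.im ≠ 0) : (Gam v₁ v₂ α z).det ≠ 0 := by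
  intro hdet
  have hz' : (conj z).im ≠ 0 := by simpa using hz
  -- The matrix of the system for `a`, `b` is the adjugate of `Γ`, which in size two has the same
  -- determinant. A null vector solves the system with `h = 0`.
  have hdet' : (!![Gam v₁ v₂ α z 1 1, -Gam v₁ v₂ α z 0 1;
      -Gam v₁ v₂ α z 1 0, Gam v₁ v₂ α z 0 0]).det = 0 := by
    rw [Matrix.det_fin_two] at hdet
    rw [Matrix.det_fin_two_of]
    linear_combination hdet
  obtain ⟨c, hc, hc0⟩ := Matrix.exists_mulVec_eq_zero_iff.2 hdet'
  have h0 (f : L2R) : pairing (0 : L2R) f = 0 := by rw [pairing_eq_inner, inner_zero_right]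
  have e0 := congrFun hc0 0
  have e1 := congrFun hc0 1
  simp only [Matrix.mulVec, dotProduct, Fin.sum_univ_two, Matrix.of_apply, Matrix.cons_val',
    Matrix.cons_val_zero, Matrix.cons_val_one, Matrix.cons_val_fin_one, Pi.zero_apply] at e0 e1
  obtain ⟨u, -, ha, hb, hd, hu⟩ := exists_nonlocalOp_eq_of_Gam v₁ v₂ 0 α hz (a := c 0) (b := c 1)
    hz' (by rw [h0]; linear_combination e0) (by rw [h0]; linear_combination e1)
  have hu0 : u = 0 := (nonlocalOp_isFormalAdjoint v₁ v₂ α).eq_zero hz ⟨u, hd⟩ hu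
  have hl := leftValue_smul 0 sobolev.zero_mem
  have hr := rightValue_smul 0 sobolev.zero_mem
  rw [zero_smul, zero_mul] at hl hr
  -- As `u = 0`, the coefficients recovered from it vanish, contradicting the choice of a nonzero
  -- null vector.
  rw [hu0, h0, hl, mul_zero, add_zero] at ha
  rw [hu0, h0, hr, mul_zero, sub_zero] at hb
  refine hc (funext fun j => ?_)
  fin_cases j
  · exact ha.symm
  · exact hb.symm

/-- The coefficients are `Γ / det Γ`, the inverse of the adjugate, applied to the right side of the
system. -/
theorem exists_nonlocalOp_sub_smul_eq (hz : z.im ≠ 0) (hz' : (conj z).im ≠ 0) :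
    ∃ ψ : (nonlocalOp v₁ v₂ α).domain, nonlocalOp v₁ v₂ α ψ - z • (ψ : L2R) = h ∧
      (ψ : L2R) = greenLp h α hz -
        ((Gam v₁ v₂ α z).det⁻¹ * (Gam v₁ v₂ α z 0 0 * pairing h (calELp₁ v₁ α hz') +
          Gam v₁ v₂ α z 0 1 * pairing h (calELp₂ v₂ α hz'))) • calELp₁ v₁ α hz -
        ((Gam v₁ v₂ α z).det⁻¹ * (Gam v₁ v₂ α z 1 0 * pairing h (calELp₁ v₁ α hz') +
          Gam v₁ v₂ α z 1 1 * pairing h (calELp₂ v₂ α hz'))) • calELp₂ v₂ α hz := by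
  have hdet := inv_mul_cancel₀ (det_Gam_ne_zero v₁ v₂ α hz)
  nth_rw 2 [Matrix.det_fin_two] at hdet
  obtain ⟨u, hu, -, -, hd, e⟩ := exists_nonlocalOp_eq_of_Gam v₁ v₂ h α hz
    (a := (Gam v₁ v₂ α z).det⁻¹ * (Gam v₁ v₂ α z 0 0 * pairing h (calELp₁ v₁ α hz') +
      Gam v₁ v₂ α z 0 1 * pairing h (calELp₂ v₂ α hz')))
    (b := (Gam v₁ v₂ α z).det⁻¹ * (Gam v₁ v₂ α z 1 0 * pairing h (calELp₁ v₁ α hz') +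
      Gam v₁ v₂ α z 1 1 * pairing h (calELp₂ v₂ α hz'))) hz'
    (by linear_combination pairing h (calELp₁ v₁ α hz') * hdet)
    (by linear_combination pairing h (calELp₂ v₂ α hz') * hdet)
  exact ⟨⟨u, hd⟩, e, hu⟩

theorem integrable_mul_conj_calE (hz : z.im ≠ 0) (k : Fin 2) :
    Integrable fun y => h y * conj (calE v₁ v₂ α z k y) :=
  (Lp.memLp h).integrable_mul (memLp_calE v₁ v₂ α hz k).star

/-- Collects the factors depending on `y`, so that the finite-rank correction integrates to pairings
with `h`. -/
theorem resolventKernel_mul (x y : ℝ) : resolventKernel v₁ v₂ α z x y * h y =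
    pointGreen α z x y * h y - ∑ k : Fin 2, (1 / (Gam v₁ v₂ α z).det *
      ∑ j : Fin 2, calE v₁ v₂ α z j x * Gam v₁ v₂ α z j k) *
        (h y * conj (calE v₁ v₂ α (conj z) k y)) := by
  simp only [resolventKernel, Fin.sum_univ_two]
  ring

theorem integrable_resolventKernel_mul (hz : z.im ≠ 0) (x : ℝ) :
    Integrable fun y => resolventKernel v₁ v₂ α z x y * h y := by
  have hz' : (conj z).im ≠ 0 := by simpa using hz
  simp only [resolventKernel_mul]
  exact (integrable_pointGreen_mul α hz h x).sub (integrable_finsetSum _ fun k _ =>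
    (integrable_mul_conj_calE v₁ v₂ h α hz' k).const_mul _)

theorem integral_resolventKernel_mul (hz : z.im ≠ 0) (x : ℝ) :
    ∫ y, resolventKernel v₁ v₂ α z x y * h y =
      greenPotential α h z x - ∑ k : Fin 2, (1 / (Gam v₁ v₂ α z).det *
        ∑ j : Fin 2, calE v₁ v₂ α z j x * Gam v₁ v₂ α z j k) *
          pairing h (calE v₁ v₂ α (conj z) k) := by
  have hz' : (conj z).im ≠ 0 := by simpa using hz
  have hi (k : Fin 2) := integrable_mul_conj_calE v₁ v₂ h α hz' k
  simp only [resolventKernel_mul]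
  rw [integral_sub (integrable_pointGreen_mul α hz h x)
    (integrable_finsetSum _ fun k _ => (hi k).const_mul _),
    integral_finsetSum _ fun k _ => (hi k).const_mul _]
  simp only [integral_const_mul]
  rfl

end Resolvent

end NonlocalMomentum

theorem theorem3p5 (v₁ v₂ : L2R) (α : ℝ) :
    IsSelfAdjoint (nonlocalOp v₁ v₂ α) ∧
    ∀ z : ℂ, z.im ≠ 0 →
      -- the boundary value and the integrals in the definitions of `E0`, `greenPotential` and
      -- `Gam` exist
      (∀ x : ℝ, Tendsto (pointGreen α z x) (𝓝[<] (0 : ℝ)) (𝓝 (E0 α z x))) ∧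
      (∀ v : L2R, ∀ x : ℝ, Integrable (fun y => pointGreen α z x y * v y)) ∧
      MemLp (E0 α z) 2 ∧
      (∀ v : L2R, MemLp (greenPotential α v z) 2) ∧
      -- properties of the matrix
      (Gam v₁ v₂ α (conj z)).conjTranspose = Gam v₁ v₂ α z ∧
      conj (Gam v₁ v₂ α (conj z)).det = (Gam v₁ v₂ α z).det ∧
      (Gam v₁ v₂ α z).det ≠ 0 ∧
      -- the resolvent and its kernel
      ∃ R : L2R →L[ℂ] L2R, IsResolvent (nonlocalOp v₁ v₂ α) z R ∧
        ∀ h : L2R,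
          (∀ x : ℝ, Integrable (fun y => resolventKernel v₁ v₂ α z x y * h y)) ∧
          ∀ᵐ x : ℝ, R h x = ∫ y, resolventKernel v₁ v₂ α z x y * h y := by
  have hA := nonlocalOp_isFormalAdjoint v₁ v₂ α
  have hsurj (z : ℂ) (hz : z.im ≠ 0) (h : L2R) : ∃ ψ : (nonlocalOp v₁ v₂ α).domain,
      nonlocalOp v₁ v₂ α ψ - z • (ψ : L2R) = h :=
    (exists_nonlocalOp_sub_smul_eq v₁ v₂ h α hz (by simpa using hz)).imp fun _ h => h.1
  refine ⟨hA.isSelfAdjoint hsurj, fun z hz => ⟨tendsto_E0 α hz,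
    integrable_pointGreen_mul α hz, memLp_E0 α hz, memLp_greenPotential α hz,
    Gam_conjTranspose v₁ v₂ α hz, ?_, det_Gam_ne_zero v₁ v₂ α hz, ?_⟩⟩
  · rw [← Gam_conjTranspose v₁ v₂ α hz, Matrix.det_conjTranspose]
    rfl
  obtain ⟨R, hR⟩ := exists_isResolvent hA hz (hsurj z hz)
  refine ⟨R, hR, fun h => ⟨integrable_resolventKernel_mul v₁ v₂ h α hz, ?_⟩⟩
  have hz' : (conj z).im ≠ 0 := by simpa using hz
  -- Replacing `h` by `(A - z)ψ` with the explicit `ψ` makes the left-inverse property give `R h =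
  -- ψ`, whose formula is then compared with the integral of the kernel.
  obtain ⟨ψ, rfl, hψ⟩ := exists_nonlocalOp_sub_smul_eq v₁ v₂ h α hz hz'
  rw [hR.2 ψ]
  generalize nonlocalOp v₁ v₂ α ψ - z • (ψ : L2R) = h at hψ ⊢
  rw [pairing_congr EventuallyEq.rfl (calELp₁_coeFn v₁ v₂ α hz'),
    pairing_congr EventuallyEq.rfl (calELp₂_coeFn v₁ v₂ α hz')] at hψ
  set a := (Gam v₁ v₂ α z).det⁻¹ * (Gam v₁ v₂ α z 0 0 * pairing h (calE v₁ v₂ α (conj z) 0) +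
    Gam v₁ v₂ α z 0 1 * pairing h (calE v₁ v₂ α (conj z) 1)) with ha
  set b := (Gam v₁ v₂ α z).det⁻¹ * (Gam v₁ v₂ α z 1 0 * pairing h (calE v₁ v₂ α (conj z) 0) +
    Gam v₁ v₂ α z 1 1 * pairing h (calE v₁ v₂ α (conj z) 1)) with hb
  rw [hψ]
  filter_upwards [Lp.coeFn_sub (greenLp h α hz - a • calELp₁ v₁ α hz) (b • calELp₂ v₂ α hz),
    Lp.coeFn_sub (greenLp h α hz) (a • calELp₁ v₁ α hz), Lp.coeFn_smul a (calELp₁ v₁ α hz),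
    Lp.coeFn_smul b (calELp₂ v₂ α hz), greenLp_coeFn h α hz, calELp₁_coeFn v₁ v₂ α hz,
    calELp₂_coeFn v₁ v₂ α hz] with x e1 e2 e3 e4 e5 e6 e7
  rw [e1, Pi.sub_apply, e2, Pi.sub_apply, e3, e4, Pi.smul_apply, Pi.smul_apply, e5, e6, e7,
    integral_resolventKernel_mul v₁ v₂ h α hz]
  simp only [Fin.sum_univ_two, smul_eq_mul, ha, hb, one_div]
  ring
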